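/- Conventions. Let $G$ be a finite undirected graph with $n$ vertices and real edge weights $w$, bipartite between $V\!C$ and $X=V\setminus V\!C$. For $x\in X$ let $N(x)$ be its set of neighbors, let $N_x$ be the star of all edges at $x$, and let $K_x$ be the clique on $N(x)$ in which the edge between two distinct $u,v\in N(x)$ has weight $\frac{w(x,u)\,w(x,v)}{\sum_{i\in N(x)}w(x,i)}$ (read as $0$ when the denominator is $0$). For $S\subseteq V\!C$ put $w(x,S)=\sum_{u\in S\cap N(x)}w(x,u)$, and let the weight of the cut minimally extended from $S$ be $$\Delta_G(S)=\sum_{x\in X}\min\{w(x,S),\,w(x,V\!C\setminus S)\}.$$ Two vertices are $k$-connected in a weighted multigraph if every cut separating them has weight at least $k$. A subset $X^{heavy}\subseteq X$ is $k$-heavy if for every $x\in X^{heavy}$ any two distinct vertices of $N(x)$ are $k$-connected in the multigraph union $\bigcup_{y\in X\setminus X^{heavy}}K_y$. Statement. For all real constants $A,c_1$ and every $c_2\ge 1$ there is a constant $C>0$, depending only on $A,c_1,c_2$, such that the following holds. Let $G$ be as above, suppose that every $x\in X$ has degree at most $d$, and that all edge weights lie in $[\gamma,U\gamma]$, where $\gamma\ge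 0$ and $U\le A\,n^{c_1}$. Let $\varepsilon>0$ and $$t\ \ge\ C\,d\,U\,\varepsilon^{-2}\log n ,$$ and let $X^{light}\subseteq X$ be such that $X^{heavy}=X\setminus X^{light}$ is a $\gamma(dU)t$-heavy subset. Let $H$ be the random graph consisting of the stars $N_x$ for all $x\in X^{light}$ together with, independently for each $x\in X^{heavy}$ with probability $1/2$, the star $N_x$ with all its weights doubled. Then, with probability at least $1-n^{-c_2}$, $$\left|\Delta_G(S)-\Delta_H(S)\right|\le\varepsilon\,\Delta_G(S)\qquad\text{for all } S\subseteq V\!C .$$ -/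

import Mathlib

open MeasureTheory ProbabilityTheory

/-- An undirected weighted graph on the vertex set `V`; the weight is extended by zero to the
pairs that are not edges. -/
structure WeightedGraph (V : Type*) where
  graph : SimpleGraph V
  weight : Sym2 V → ℝ
  weight_eq_zero : ∀ e, e ∉ graph.edgeSet → weight e = 0

namespace WeightedGraph

variable {V : Type*}

/-- The union of a finite family of weighted graphs. Parallel edges are merged into one edge
carrying their total weight, which changes neither cuts nor connectivities. -/
def iUnion {ι : Type*} (s : Finset ι) (F : ι → WeightedGraph V) : WeightedGraph V where
  graph := ⨆ i ∈ s, (F i).graph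
  weight e := ∑ i ∈ s, (F i).weight e
  weight_eq_zero := by
    intro e he
    refine Finset.sum_eq_zero fun i hi => (F i).weight_eq_zero e fun h => he ?_
    exact SimpleGraph.edgeSet_mono (le_iSup₂ (f := fun i (_ : i ∈ s) => (F i).graph) i hi) h

/-- The union of two weighted graphs, parallel edges being merged. -/
def union (G H : WeightedGraph V) : WeightedGraph V where
  graph := G.graph ⊔ H.graph
  weight e := G.weight e + H.weight e
  weight_eq_zero := by
    intro e he
    rw [SimpleGraph.edgeSet_sup, Set.mem_union, not_or] at he
    rw [G.weight_eq_zero e he.1, H.weight_eq_zero e he.2, add_zero]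

/-- The graph `c G`: all edge weights are multiplied by `c`. -/
def scale (c : ℝ) (G : WeightedGraph V) : WeightedGraph V where
  graph := G.graph
  weight e := c * G.weight e
  weight_eq_zero := by
    intro e he
    rw [G.weight_eq_zero e he, mul_zero]

variable [Fintype V] [DecidableEq V]

open Classical in
/-- The neighborhood `N(x)`. -/
noncomputable def nbhd (G : WeightedGraph V) (x : V) : Finset V :=
  Finset.univ.filter fun u => G.graph.Adj x u

/-- The star `N_x`: all edges of `G` incident to `x`, with their weights. -/
def star (G : WeightedGraph V) (x : V) : WeightedGraph V where
  graph :=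
    { Adj := fun u v => G.graph.Adj u v ∧ (x = u ∨ x = v)
      symm := ⟨fun _ _ h => ⟨h.1.symm, h.2.symm⟩⟩
      loopless := ⟨fun u h => G.graph.loopless.irrefl u h.1⟩ }
  weight e := if x ∈ e then G.weight e else 0
  weight_eq_zero := by
    intro e
    induction e with
    | _ u v =>
      intro he
      split_ifs with hx
      · exact G.weight_eq_zero _ fun h => he ⟨h, Sym2.mem_iff.1 hx⟩
      · rfl

/-- The clique `K_x` obtained by eliminating `x`: an edge between any two distinct neighbors
`u`, `v` of `x`, of weight `w(x,u) w(x,v) / ∑_{i ∈ N(x)} w(x,i)`. -/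
noncomputable def clique (G : WeightedGraph V) (x : V) : WeightedGraph V where
  graph :=
    { Adj := fun u v => u ≠ v ∧ u ∈ G.nbhd x ∧ v ∈ G.nbhd x
      symm := ⟨fun _ _ h => ⟨h.1.symm, h.2.2, h.2.1⟩⟩
      loopless := ⟨fun _ h => h.1 rfl⟩ }
  weight := Sym2.lift
    ⟨fun u v =>
      if u ≠ v ∧ u ∈ G.nbhd x ∧ v ∈ G.nbhd x then
        G.weight s(x, u) * G.weight s(x, v) / ∑ i ∈ G.nbhd x, G.weight s(x, i)
      else 0, by
      intro u v
      have h : (u ≠ v ∧ u ∈ G.nbhd x ∧ v ∈ G.nbhd x) ↔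
          (v ≠ u ∧ v ∈ G.nbhd x ∧ u ∈ G.nbhd x) := by
        constructor <;> exact fun h => ⟨h.1.symm, h.2.2, h.2.1⟩
      simp only [h, mul_comm (G.weight s(x, u))]⟩
  weight_eq_zero := by
    intro e
    induction e with
    | _ u v =>
      intro he
      exact if_neg he

/-- The weight of the cut `(S, V \ S)`. -/
def cutWeight (G : WeightedGraph V) (S : Finset V) : ℝ :=
  ∑ u ∈ S, ∑ v ∈ Sᶜ, G.weight s(u, v)

/-- `u` and `v` are `k`-connected: every cut separating them has weight at least `k`. -/
def KConnected (G : WeightedGraph V) (k : ℝ) (u v : V) : Prop :=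
  ∀ S : Finset V, u ∈ S → v ∉ S → k ≤ G.cutWeight S

/-- `w(x, S)`, the total weight of the edges from `x` into `S`. -/
noncomputable def weightTo (G : WeightedGraph V) (x : V) (S : Finset V) : ℝ :=
  ∑ u ∈ S ∩ G.nbhd x, G.weight s(x, u)

/-- For a vertex cover `VC` with complement `X`, the weight `Δ_G(S)` of the cut minimally
extended from `S ⊆ VC`: the weight of the cut `(S, VC \ S)` in `G \ X`, plus
`min {w(x, S), w(x, VC \ S)}` for every `x ∈ X`. -/
noncomputable def minExtCut (G : WeightedGraph V) (VC S : Finset V) : ℝ :=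
  (∑ u ∈ S, ∑ v ∈ VC \ S, G.weight s(u, v)) +
    ∑ x ∈ VCᶜ, min (G.weightTo x S) (G.weightTo x (VC \ S))

/-- `heavy ⊆ X` is a `k`-heavy subset of `X = V \ VC`: any two distinct neighbors of a vertex of
`heavy` are `k`-connected in the union of the cliques `K_x` over `x ∈ X \ heavy`. -/
def IsHeavySubset (G : WeightedGraph V) (VC heavy : Finset V) (k : ℝ) : Prop :=
  heavy ⊆ VCᶜ ∧ ∀ x ∈ heavy, ∀ u ∈ G.nbhd x, ∀ v ∈ G.nbhd x, u ≠ v →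
    (iUnion (VCᶜ \ heavy) G.clique).KConnected k u v

/-- The output of the sampling routine when `heads` is the set of vertices whose coin came up
heads: the union of the stars `2 N_x` over `x ∈ heads`. -/
def sample (G : WeightedGraph V) (heads : Finset V) : WeightedGraph V :=
  iUnion heads fun x => scale 2 (G.star x)

/-- The light stars together with the sampled heavy stars. Vertices that are dropped stay as
isolated vertices, which contribute nothing to any cut. -/
def lightAndSample (G : WeightedGraph V) (light heads : Finset V) : WeightedGraph V :=
  union (iUnion light G.star) (G.sample heads)

end WeightedGraph

/-! Write `Δ(S)` for the minimally extended cut. Light stars cancel in `Δ_G(S) - Δ_H(S)`, which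
leaves a sum of independent random signs times the star contributions of the heavy vertices. Each
contribution is at most `D = γ d U`, so their squares sum to at most `D Δ_G(S)`. With `k = D t`,
Hoeffding's inequality bounds the failure probability of a cut with `m k ≤ Δ_G(S) ≤ 2 m k` by `2 exp
(-ε² t m / 4)`.

A union bound over all `S` would be too expensive. However, the signed sum depends only on the
projection of `S`: the set of pairs of neighbors of a common heavy vertex that `S` separates
(`starCut_eq_of_sepPairs_eq`). Heaviness says that a cut separating such a pair has weight at least
`k` in the union of the light cliques, and this clique cut weighs at most `Δ_G(S)`, because `a b /
(a + b) ≤ min a b`. It therefore suffices to count projections of cuts of weight at most `2 m k` in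
the clique graph; `card_projections_le` gives `16 ^ (2 m) * n ^ (8 m)`, which the tail bound beats
once `ε² t` is a large multiple of `log n`.

The count is Karger's contraction argument with averaging in place of random contraction. By
`exists_splitting_off` all weight can be moved onto the terminals, the vertices in nontrivial pairs,
without increasing a cut or breaking the lower bound `K` for separating cuts. With `r` terminals the
total weight is then a large multiple of the weight of any cut being counted, so an average edge is
uncut by most of these cuts. Contracting an edge removes a terminal, which allows induction on `r`.
-/

set_option linter.unusedSectionVars false

/-! ### Cut functions on ordered pairs, and uncrossing. -/

namespace WeightedCut

variable {V ι : Type*} [Fintype V] [DecidableEq V]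

/-- The indicator of `S` separating `u` and `v`. -/
def sepInd (S : Finset V) (u v : V) : ℝ := if u ∈ S ↔ v ∈ S then 0 else 1

/-- The sum of `w` over all ordered pairs separated by `S`; for symmetric `w` this is twice the
weight of the cut `S`. -/
def cutSum (w : V → V → ℝ) (S : Finset V) : ℝ := ∑ u, ∑ v, w u v * sepInd S u v

/-- `S` separates one of the pairs of the family `F`. -/
def Separates (F : ι → V × V) (S : Finset V) : Prop := ∃ i, ¬((F i).1 ∈ S ↔ (F i).2 ∈ S)

open Classical in
/-- The vertices that occur in a pair of distinct vertices of the family `F`. -/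
noncomputable def terminals (F : ι → V × V) : Finset V :=
  Finset.univ.filter fun v => ∃ i, (F i).1 ≠ (F i).2 ∧ ((F i).1 = v ∨ (F i).2 = v)

/-- The adjacency indicator of the edge `ab`; it vanishes if `a = b`. -/
def edgeInd (a b u v : V) : ℝ := if u ≠ v ∧ (u = a ∧ v = b ∨ u = b ∧ v = a) then 1 else 0

lemma sepInd_nonneg (S : Finset V) (u v : V) : 0 ≤ sepInd S u v := by
  unfold sepInd; split_ifs <;> norm_num

lemma sepInd_comm (S : Finset V) (u v : V) : sepInd S u v = sepInd S v u := by
  unfold sepInd; simp only [iff_comm]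

lemma sepInd_self (S : Finset V) (u : V) : sepInd S u u = 0 := by simp [sepInd]

lemma sepInd_compl (S : Finset V) (u v : V) : sepInd Sᶜ u v = sepInd S u v := by
  simp only [sepInd, Finset.mem_compl, not_iff_not]

lemma edgeInd_nonneg (a b u v : V) : 0 ≤ edgeInd a b u v := by
  unfold edgeInd; split_ifs <;> norm_num

lemma edgeInd_comm (a b u v : V) : edgeInd a b u v = edgeInd a b v u := by
  unfold edgeInd
  refine if_congr ?_ rfl rfl
  constructor <;> rintro ⟨h, h'⟩ <;> exact ⟨h.symm, h'.symm.imp And.symm And.symm⟩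

lemma edgeInd_self (a b u : V) : edgeInd a b u u = 0 := by simp [edgeInd]

lemma sum_edgeInd_mul (g : V → V → ℝ) (hg : ∀ u v, g u v = g v u) (hg0 : ∀ u, g u u = 0)
    (a b : V) : ∑ u, ∑ v, edgeInd a b u v * g u v = 2 * g a b := by
  by_cases hab : a = b
  · subst hab
    rw [hg0, mul_zero]
    refine Finset.sum_eq_zero fun u _ => Finset.sum_eq_zero fun v _ => ?_
    unfold edgeInd
    rw [if_neg, zero_mul]
    rintro ⟨h, ⟨rfl, rfl⟩ | ⟨rfl, rfl⟩⟩ <;> exact h rfl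
  · have h : ∀ u v, edgeInd a b u v * g u v =
        (if u = a then if v = b then g a b else 0 else 0) +
          (if u = b then if v = a then g a b else 0 else 0) := by
      intro u v
      unfold edgeInd
      split_ifs <;> grind
    simp only [h, Finset.sum_add_distrib]
    simp
    ring

lemma cutSum_nonneg {w : V → V → ℝ} (hw : ∀ u v, 0 ≤ w u v) (S : Finset V) : 0 ≤ cutSum w S :=
  Finset.sum_nonneg fun _ _ => Finset.sum_nonneg fun _ _ => mul_nonneg (hw _ _) (sepInd_nonneg _ _ _)

lemma cutSum_compl (w : V → V → ℝ) (S : Finset V) : cutSum w Sᶜ = cutSum w S := by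
  simp only [cutSum, sepInd_compl]

lemma Separates.compl {F : ι → V × V} {S : Finset V} (h : Separates F S) : Separates F Sᶜ := by
  obtain ⟨i, hi⟩ := h
  exact ⟨i, by simpa only [Finset.mem_compl, not_iff_not] using hi⟩

lemma mem_terminals {F : ι → V × V} {v : V} :
    v ∈ terminals F ↔ ∃ i, (F i).1 ≠ (F i).2 ∧ ((F i).1 = v ∨ (F i).2 = v) := by
  simp [terminals]

lemma mem_terminals_of_ne {F : ι → V × V} {i : ι} (h : (F i).1 ≠ (F i).2) :
    (F i).1 ∈ terminals F ∧ (F i).2 ∈ terminals F :=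
  ⟨mem_terminals.2 ⟨i, h, .inl rfl⟩, mem_terminals.2 ⟨i, h, .inr rfl⟩⟩

/-- The effect on cuts of splitting off `e` units from `za` and `zb` to `ab`; the factor 2 comes
from counting ordered pairs. -/
lemma cutSum_add_mul_edgeInd (w : V → V → ℝ) (e : ℝ) (a b z : V) (S : Finset V) :
    cutSum (fun u v => w u v + e * (edgeInd a b u v - edgeInd z a u v - edgeInd z b u v)) S =
      cutSum w S + 2 * e * (sepInd S a b - sepInd S z a - sepInd S z b) := by
  have h := fun a b => sum_edgeInd_mul (sepInd S) (sepInd_comm S) (sepInd_self S) a b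
  have h3 : 2 * e * (sepInd S a b - sepInd S z a - sepInd S z b) =
      e * (2 * sepInd S a b - 2 * sepInd S z a - 2 * sepInd S z b) := by ring
  rw [h3, ← h a b, ← h z a, ← h z b]
  simp only [cutSum, Finset.mul_sum, ← Finset.sum_sub_distrib, ← Finset.sum_add_distrib]
  refine Finset.sum_congr rfl fun u _ => Finset.sum_congr rfl fun v _ => ?_
  ring

lemma cutSum_inter_add_cutSum_union_le {w : V → V → ℝ} (hw : ∀ u v, 0 ≤ w u v) (X Y : Finset V) :
    cutSum w (X ∩ Y) + cutSum w (X ∪ Y) ≤ cutSum w X + cutSum w Y := by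
  simp only [cutSum, ← Finset.sum_add_distrib, ← mul_add]
  refine Finset.sum_le_sum fun u _ => Finset.sum_le_sum fun v _ =>
    mul_le_mul_of_nonneg_left ?_ (hw u v)
  simp only [sepInd, Finset.mem_inter, Finset.mem_union]
  by_cases u ∈ X <;> by_cases v ∈ X <;> by_cases u ∈ Y <;> by_cases v ∈ Y <;> simp [*]

/-- Posimodularity with a gain: the edge `za` joins `X ∩ Y` to the outside of `X ∪ Y`, so it crosses
both `X` and `Y` but neither difference. Two cuts and two orientations give the 4. -/
lemma cutSum_sdiff_add_cutSum_sdiff_le {w : V → V → ℝ} (hw : ∀ u v, 0 ≤ w u v)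
    (hsymm : ∀ u v, w u v = w v u) (hdiag : ∀ u, w u u = 0) {X Y : Finset V} {a z : V}
    (haX : a ∈ X) (haY : a ∈ Y) (hzX : z ∉ X) (hzY : z ∉ Y) :
    cutSum w (X \ Y) + cutSum w (Y \ X) + 4 * w z a ≤ cutSum w X + cutSum w Y := by
  have h4 : 4 * w z a = ∑ u, ∑ v, w u v * (2 * edgeInd z a u v) := by
    rw [show 4 * w z a = 2 * (2 * w z a) by ring, ← sum_edgeInd_mul w hsymm hdiag z a]
    simp only [Finset.mul_sum]
    exact Finset.sum_congr rfl fun u _ => Finset.sum_congr rfl fun v _ => by ring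
  rw [h4]
  simp only [cutSum, ← Finset.sum_add_distrib, ← mul_add]
  refine Finset.sum_le_sum fun u _ => Finset.sum_le_sum fun v _ =>
    mul_le_mul_of_nonneg_left ?_ (hw u v)
  by_cases he : u ≠ v ∧ (u = z ∧ v = a ∨ u = a ∧ v = z)
  · obtain ⟨-, ⟨rfl, rfl⟩ | ⟨rfl, rfl⟩⟩ := he
    · have : edgeInd u v u v ≤ 1 := by unfold edgeInd; split_ifs <;> norm_num
      simp only [sepInd, Finset.mem_sdiff]
      simp [*]
      linarith
    · have : edgeInd v u u v ≤ 1 := by unfold edgeInd; split_ifs <;> norm_num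
      simp only [sepInd, Finset.mem_sdiff]
      simp [*]
      linarith
  · rw [edgeInd, if_neg he]
    simp only [sepInd, Finset.mem_sdiff]
    by_cases u ∈ X <;> by_cases v ∈ X <;> by_cases u ∈ Y <;> by_cases v ∈ Y <;> simp [*]

/-- The sets that separate a pair of `F` form a skew-supermodular family. -/
lemma Separates.uncross {F : ι → V × V} {X Y : Finset V} (hX : Separates F X)
    (hY : Separates F Y) :
    (Separates F (X ∩ Y) ∧ Separates F (X ∪ Y)) ∨ (Separates F (X \ Y) ∧ Separates F (Y \ X)) := by
  have key : ∀ (i : ι) (Z : Finset V), ¬((F i).1 ∈ Z ↔ (F i).2 ∈ Z) → Separates F Z :=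
    fun i Z h => ⟨i, h⟩
  -- A pair separated by `X` separates two of the four corner sets, according to how it meets `Y`.
  -- Combining this with the same list for a pair separated by `Y` always yields one of the two
  -- required couples.
  have hX' : (Separates F (X ∩ Y) ∧ Separates F (X ∪ Y)) ∨
      (Separates F (X \ Y) ∧ Separates F (Y \ X)) ∨
      (Separates F (X ∩ Y) ∧ Separates F (Y \ X)) ∨
      (Separates F (X \ Y) ∧ Separates F (X ∪ Y)) := by
    obtain ⟨i, hi⟩ := hX
    have h1 := key i (X ∩ Y)
    have h2 := key i (X ∪ Y)
    have h3 := key i (X \ Y)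
    have h4 := key i (Y \ X)
    simp only [Finset.mem_inter, Finset.mem_union, Finset.mem_sdiff] at h1 h2 h3 h4
    by_cases a1 : (F i).1 ∈ X <;> by_cases a2 : (F i).2 ∈ X <;>
    by_cases a3 : (F i).1 ∈ Y <;> by_cases a4 : (F i).2 ∈ Y <;> simp_all
  have hY' : (Separates F (X ∩ Y) ∧ Separates F (X ∪ Y)) ∨
      (Separates F (X \ Y) ∧ Separates F (Y \ X)) ∨
      (Separates F (X ∩ Y) ∧ Separates F (X \ Y)) ∨
      (Separates F (Y \ X) ∧ Separates F (X ∪ Y)) := by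
    obtain ⟨i, hi⟩ := hY
    have h1 := key i (X ∩ Y)
    have h2 := key i (X ∪ Y)
    have h3 := key i (X \ Y)
    have h4 := key i (Y \ X)
    simp only [Finset.mem_inter, Finset.mem_union, Finset.mem_sdiff] at h1 h2 h3 h4
    by_cases a1 : (F i).1 ∈ X <;> by_cases a2 : (F i).2 ∈ X <;>
    by_cases a3 : (F i).1 ∈ Y <;> by_cases a4 : (F i).2 ∈ Y <;> simp_all
  tauto

/-- All edges at `z` lead into `Z`, so moving `z` inside uncuts every one of them and cuts nothing
new. -/
lemma cutSum_insert_add_le {w : V → V → ℝ} (hw : ∀ u v, 0 ≤ w u v)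
    (hsymm : ∀ u v, w u v = w v u) (hdiag : ∀ u, w u u = 0) {Z : Finset V} {a z : V}
    (hz : z ∉ Z) (hZ : ∀ v, 0 < w z v → v ∈ Z) :
    cutSum w (insert z Z) + 2 * w z a ≤ cutSum w Z := by
  rw [← sum_edgeInd_mul w hsymm hdiag z a]
  simp only [cutSum, ← Finset.sum_add_distrib]
  refine Finset.sum_le_sum fun u _ => Finset.sum_le_sum fun v _ => ?_
  have h0 : ∀ v, v ∉ Z → w z v = 0 := fun v hv =>
    le_antisymm (not_lt.1 fun h => hv (hZ v h)) (hw z v)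
  have hE : edgeInd z a u v ≤ 1 := by unfold edgeInd; split_ifs <;> norm_num
  have hmul : edgeInd z a u v * w u v ≤ w u v := by nlinarith [hw u v]
  by_cases hu : u = z
  · subst hu
    by_cases hv : v ∈ Z
    · simp [sepInd, hz, hv, hmul]
    · simp [h0 v hv]
  · by_cases hv : v = z
    · subst hv
      by_cases hu' : u ∈ Z
      · simp [sepInd, hz, hu', hmul]
      · simp [hsymm u v, h0 u hu']
    · have : edgeInd z a u v = 0 := by simp [edgeInd, hu, hv]
      simp [this, sepInd, hu, hv]

/-! ### Splitting off nonterminal vertices. -/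

/-- Fractional splitting off: the weight can be moved onto the terminals such that no cut
increases, while every cut that separates a pair of `F` keeps its lower bound `K`. -/
theorem exists_splitting_off [Finite ι] (F : ι → V × V) (K : ℝ) (w : V → V → ℝ)
    (hw : ∀ u v, 0 ≤ w u v) (hsymm : ∀ u v, w u v = w v u)
    (hK : ∀ S, Separates F S → K ≤ cutSum w S) :
    ∃ w' : V → V → ℝ, (∀ u v, 0 ≤ w' u v) ∧ (∀ u v, w' u v = w' v u) ∧ (∀ u, w' u u = 0) ∧
      (∀ S, cutSum w' S ≤ cutSum w S) ∧ (∀ S, Separates F S → K ≤ cutSum w' S) ∧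
      ∀ z, z ∉ terminals F → ∀ v, w' z v = 0 := by
  classical
  set 𝓕 : Set (V → V → ℝ) := {w' | (∀ u v, 0 ≤ w' u v) ∧ (∀ u v, w' u v = w' v u) ∧
    (∀ u, w' u u = 0) ∧ (∀ S, cutSum w' S ≤ cutSum w S) ∧
    (∀ S, Separates F S → K ≤ cutSum w' S)} with h𝓕
  have hcont : ∀ S, Continuous fun w' : V → V → ℝ => cutSum w' S := by
    intro S; unfold cutSum; fun_prop
  -- Each `w' u v` is bounded by the degree cut of `u`, which cannot exceed that of `w`.
  have hcomp : IsCompact 𝓕 := by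
    refine IsCompact.of_isClosed_subset (isCompact_Icc (a := (0 : V → V → ℝ))
      (b := fun u _ => cutSum w {u})) ?_ ?_
    · simp only [h𝓕, Set.ofPred_and, Set.ofPred_forall]
      refine IsClosed.inter ?_ (IsClosed.inter ?_ (IsClosed.inter ?_ (IsClosed.inter ?_ ?_)))
      · exact isClosed_iInter fun u => isClosed_iInter fun v =>
          isClosed_le continuous_const (by fun_prop)
      · exact isClosed_iInter fun u => isClosed_iInter fun v =>
          isClosed_eq (by fun_prop) (by fun_prop)
      · exact isClosed_iInter fun u => isClosed_eq (by fun_prop) continuous_const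
      · exact isClosed_iInter fun S => isClosed_le (hcont S) continuous_const
      · exact isClosed_iInter fun S => isClosed_iInter fun _ =>
          isClosed_le continuous_const (hcont S)
    · rintro w' ⟨h0, -, hd, hle, -⟩
      refine ⟨fun u v => h0 u v, fun u v => le_trans ?_ (hle {u})⟩
      by_cases huv : v = u
      · rw [huv, hd]; exact cutSum_nonneg h0 _
      · have h1 : w' u v * sepInd {u} u v ≤ ∑ v, w' u v * sepInd {u} u v :=
          Finset.single_le_sum (f := fun v => w' u v * sepInd {u} u v)
            (fun v _ => mul_nonneg (h0 u v) (sepInd_nonneg _ _ _)) (Finset.mem_univ v)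
        have h2 : ∑ v, w' u v * sepInd {u} u v ≤ cutSum w' {u} :=
          Finset.single_le_sum (f := fun x => ∑ v, w' x v * sepInd {u} x v)
            (fun x _ => Finset.sum_nonneg fun v _ => mul_nonneg (h0 x v) (sepInd_nonneg _ _ _))
            (Finset.mem_univ u)
        have h3 : sepInd {u} u v = 1 := by simp [sepInd, huv]
        rw [h3, mul_one] at h1
        exact h1.trans h2
  have hne : 𝓕.Nonempty := by
    have hcut : ∀ S, cutSum (fun u v => if u = v then 0 else w u v) S = cutSum w S := by
      intro S
      refine Finset.sum_congr rfl fun u _ => Finset.sum_congr rfl fun v _ => ?_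
      dsimp only
      split_ifs with h
      · rw [h, sepInd_self]; simp
      · rfl
    refine ⟨fun u v => if u = v then 0 else w u v, ?_, ?_, ?_, ?_, ?_⟩
    · intro u v; dsimp only; split_ifs; exacts [le_rfl, hw u v]
    · intro u v; simp only [eq_comm (a := u), hsymm u v]
    · intro u; simp
    · intro S; rw [hcut]
    · intro S hS; rw [hcut]; exact hK S hS
  -- `Φ` charges weight by its number of nonterminal ends. A minimizer of `Φ` over `𝓕` turns out to
  -- have no weight at nonterminals.
  set ν : V → ℝ := fun v => if v ∈ terminals F then 0 else 1 with hν
  set g : V → V → ℝ := fun u v => if u = v then 0 else ν u + ν v with hg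
  set Φ : (V → V → ℝ) → ℝ := fun w' => ∑ u, ∑ v, w' u v * g u v with hΦ
  obtain ⟨w', ⟨h0, hs, hd, hle, hk⟩, hmin⟩ := hcomp.exists_isMinOn hne
    (f := Φ) (by rw [hΦ]; fun_prop)
  refine ⟨w', h0, hs, hd, hle, hk, fun z hz a => ?_⟩
  by_contra hza
  replace hza : 0 < w' z a := lt_of_le_of_ne (h0 z a) (Ne.symm hza)
  have hne_z : ∀ b, 0 < w' z b → b ≠ z := by
    rintro b hb rfl; rw [hd] at hb; exact lt_irrefl _ hb
  -- Splitting off at `za`, `zb` would lower `Φ`, so a tight set must block it. The choice `b = a`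
  -- is allowed and amounts to deleting weight from `za`.
  have htight : ∀ b, 0 < w' z b → ∃ X, Separates F X ∧ cutSum w' X = K ∧ z ∉ X ∧ a ∈ X ∧ b ∈ X := by
    intro b hzb
    by_contra hcon
    push Not at hcon
    -- `2 * e` covers the case `a = b`, where `za` is reduced twice; `4 * e` is what a cut loses
    -- when it has `a`, `b` on one side and `z` on the other.
    have hev : ∀ᶠ e : ℝ in nhdsWithin 0 (Set.Ioi 0), 2 * e ≤ w' z a ∧ 2 * e ≤ w' z b ∧
        ∀ S, K < cutSum w' S → K ≤ cutSum w' S - 4 * e := by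
      have hc : ∀ c : ℝ, ∀ x, 0 < x → ∀ᶠ e : ℝ in nhdsWithin 0 (Set.Ioi 0), c * e ≤ x := by
        intro c x hx
        have : Filter.Tendsto (fun e : ℝ => c * e) (nhdsWithin 0 (Set.Ioi 0)) (nhds (c * 0)) :=
          ((continuous_const.mul continuous_id).tendsto 0).mono_left nhdsWithin_le_nhds
        rw [mul_zero] at this
        exact (this.eventually (gt_mem_nhds hx)).mono fun _ h => le_of_lt h
      refine (hc 2 _ hza).and ((hc 2 _ hzb).and (Filter.eventually_all.2 fun S => ?_))
      by_cases hS : K < cutSum w' S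
      · exact (hc 4 _ (sub_pos.2 hS)).mono fun e he _ => by linarith
      · exact Filter.Eventually.of_forall fun e h => absurd h hS
    obtain ⟨e, ⟨hea, heb, heS⟩, he⟩ := (hev.and self_mem_nhdsWithin).exists
    replace he : 0 < e := he
    set w'' : V → V → ℝ := fun u v =>
      w' u v + e * (edgeInd a b u v - edgeInd z a u v - edgeInd z b u v) with hw''
    have hcut : ∀ S, cutSum w'' S =
        cutSum w' S + 2 * e * (sepInd S a b - sepInd S z a - sepInd S z b) :=
      fun S => cutSum_add_mul_edgeInd w' e a b z S
    have hmem : w'' ∈ 𝓕 := by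
      refine ⟨fun u v => ?_, fun u v => ?_, fun u => ?_, fun S => ?_, ?_⟩
      · have h1 := edgeInd_nonneg a b u v
        have hle1 : ∀ b, edgeInd z b u v ≤ 1 := fun b => by
          unfold edgeInd; split_ifs <;> norm_num
        have hval : ∀ b, edgeInd z b u v ≠ 0 → w' u v = w' z b := by
          intro b hb
          unfold edgeInd at hb
          split_ifs at hb with hcond
          · obtain ⟨-, ⟨rfl, rfl⟩ | ⟨rfl, rfl⟩⟩ := hcond
            · rfl
            · exact hs _ _
          · exact absurd rfl hb
        by_cases hA : edgeInd z a u v = 0 <;> by_cases hB : edgeInd z b u v = 0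
        · have := h0 u v; simp only [hw'', hA, hB]; nlinarith
        · have := hval b hB; simp only [hw'', hA]; nlinarith [hle1 b]
        · have := hval a hA; simp only [hw'', hB]; nlinarith [hle1 a]
        · have := hval a hA; simp only [hw'']; nlinarith [hle1 a, hle1 b]
      · simp only [hw'', hs u v, edgeInd_comm _ _ u v]
      · simp only [hw'', hd, edgeInd_self]; ring
      · rw [hcut]
        have : sepInd S a b - sepInd S z a - sepInd S z b ≤ 0 := by
          simp only [sepInd]
          by_cases a ∈ S <;> by_cases b ∈ S <;> by_cases z ∈ S <;> simp [*]
        nlinarith [hle S]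
      · have hwlog : ∀ S, Separates F S → z ∉ S → K ≤ cutSum w'' S := by
          intro S hS hzS
          rw [hcut]
          by_cases hab : a ∈ S ∧ b ∈ S
          · have hlt : K < cutSum w' S := lt_of_le_of_ne (hk S hS) fun h =>
              hcon S hS h.symm hzS hab.1 hab.2
            have := heS S hlt
            simp only [sepInd, hab.1, hab.2, hzS]
            norm_num
            linarith
          · have : sepInd S a b - sepInd S z a - sepInd S z b = 0 := by
              simp only [sepInd]
              by_cases ha : a ∈ S <;> by_cases hb : b ∈ S <;> simp_all
            rw [this, mul_zero, add_zero]
            exact hk S hS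
        intro S hS
        by_cases hzS : z ∈ S
        · rw [← cutSum_compl]
          exact hwlog _ hS.compl (by simpa using hzS)
        · exact hwlog S hS hzS
    have hgs : ∀ u v, g u v = g v u := by
      intro u v; simp only [hg, eq_comm (a := u), add_comm]
    have hg0 : ∀ u, g u u = 0 := by intro u; simp [hg]
    have hΦ' : Φ w'' = Φ w' + e * (2 * g a b - 2 * g z a - 2 * g z b) := by
      rw [← sum_edgeInd_mul g hgs hg0 a b, ← sum_edgeInd_mul g hgs hg0 z a,
        ← sum_edgeInd_mul g hgs hg0 z b]
      simp only [hΦ, hw'', Finset.mul_sum, ← Finset.sum_sub_distrib, ← Finset.sum_add_distrib]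
      refine Finset.sum_congr rfl fun u _ => Finset.sum_congr rfl fun v _ => ?_
      ring
    have hν0 : ∀ v, 0 ≤ ν v := by intro v; simp only [hν]; split_ifs <;> norm_num
    have hνz : ν z = 1 := by simp [hν, hz]
    have hgza : g z a = 1 + ν a := by simp [hg, hνz, (hne_z a hza).symm]
    have hgzb : g z b = 1 + ν b := by simp [hg, hνz, (hne_z b hzb).symm]
    have hgab : g a b ≤ ν a + ν b := by
      simp only [hg]; split_ifs
      · exact add_nonneg (hν0 a) (hν0 b)
      · exact le_rfl
    have := isMinOn_iff.1 hmin w'' hmem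
    rw [hΦ', hgza, hgzb] at this
    nlinarith
  -- Tight sets containing `a` but not `z` are closed under union: in the other uncrossing case, the
  -- positive edge `za` would push a separating set below `K`.
  have hunion : ∀ N : Finset V, (∀ b ∈ N, 0 < w' z b) →
      ∃ X, Separates F X ∧ cutSum w' X = K ∧ z ∉ X ∧ a ∈ X ∧ N ⊆ X := by
    intro N
    induction N using Finset.induction_on with
    | empty =>
      intro _
      obtain ⟨X, h1, h2, h3, h4, -⟩ := htight a hza
      exact ⟨X, h1, h2, h3, h4, Finset.empty_subset _⟩
    | insert b N _ ih =>
      intro hN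
      obtain ⟨X, hX, hXK, hzX, haX, hNX⟩ := ih fun c hc => hN c (Finset.mem_insert_of_mem hc)
      obtain ⟨Y, hY, hYK, hzY, haY, hbY⟩ := htight b (hN b (Finset.mem_insert_self _ _))
      rcases hX.uncross hY with ⟨hi, hu⟩ | ⟨h1, h2⟩
      · refine ⟨X ∪ Y, hu, le_antisymm ?_ (hk _ hu), by simp [hzX, hzY], by simp [haX], ?_⟩
        · have := cutSum_inter_add_cutSum_union_le h0 X Y
          have := hk _ hi
          linarith
        · exact Finset.insert_subset (Finset.mem_union_right _ hbY)
            (hNX.trans Finset.subset_union_left)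
      · have := cutSum_sdiff_add_cutSum_sdiff_le h0 hs hd haX haY hzX hzY
        have := hk _ h1
        have := hk _ h2
        linarith
  obtain ⟨Z, hZ, hZK, hzZ, -, hNZ⟩ := hunion (Finset.univ.filter fun b => 0 < w' z b)
    (by simp)
  -- Since `z` is not a terminal, adding it to the tight set `Z` affects no separated pair, yet the
  -- cut drops strictly below `K`.
  have hins : Separates F (insert z Z) := by
    obtain ⟨i, hi⟩ := hZ
    have ht := mem_terminals_of_ne fun h => hi (by rw [h])
    refine ⟨i, ?_⟩
    have h1 : (F i).1 ≠ z := fun h => hz (h ▸ ht.1)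
    have h2 : (F i).2 ≠ z := fun h => hz (h ▸ ht.2)
    simpa [h1, h2] using hi
  have := cutSum_insert_add_le h0 hs hd (a := a) hzZ fun v hv => hNZ (by simpa using hv)
  have := hk _ hins
  linarith

/-! ### Contraction and the count of projections. -/

/-- The image of the weight `w` under a vertex map `f`, parallel edges being merged. -/
def pushWeight (f : V → V) (w : V → V → ℝ) (u v : V) : ℝ :=
  ∑ q : V × V, if (f q.1, f q.2) = (u, v) then w q.1 q.2 else 0

lemma cutSum_pushWeight (f : V → V) (w : V → V → ℝ) (S : Finset V) :
    cutSum (pushWeight f w) S = cutSum w (Finset.univ.filter fun v => f v ∈ S) := by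
  have h1 : cutSum (pushWeight f w) S = ∑ p : V × V, ∑ q : V × V,
      if (f q.1, f q.2) = p then w q.1 q.2 * sepInd S p.1 p.2 else 0 := by
    rw [Fintype.sum_prod_type]
    refine Finset.sum_congr rfl fun u _ => Finset.sum_congr rfl fun v _ => ?_
    rw [pushWeight, Finset.sum_mul]
    refine Finset.sum_congr rfl fun q _ => ?_
    split_ifs <;> simp
  rw [h1, Finset.sum_comm]
  simp only [Finset.sum_ite_eq, Finset.mem_univ, if_true]
  rw [Fintype.sum_prod_type]
  refine Finset.sum_congr rfl fun u _ => Finset.sum_congr rfl fun v _ => ?_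
  simp [sepInd]

lemma pushWeight_nonneg (f : V → V) {w : V → V → ℝ} (hw : ∀ u v, 0 ≤ w u v) (u v : V) :
    0 ≤ pushWeight f w u v :=
  Finset.sum_nonneg fun q _ => by split_ifs; exacts [hw _ _, le_rfl]

lemma pushWeight_symm (f : V → V) {w : V → V → ℝ} (hw : ∀ u v, w u v = w v u) (u v : V) :
    pushWeight f w u v = pushWeight f w v u := by
  unfold pushWeight
  rw [← (Equiv.prodComm V V).sum_comp]
  refine Finset.sum_congr rfl fun q _ => ?_
  simp only [Equiv.prodComm_apply, Prod.fst_swap, Prod.snd_swap, Prod.mk.injEq, hw q.2 q.1,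
    and_comm]

/-- The projection of the cut `S` to the family of pairs `F`: the pairs that `S` separates. -/
def sepPairs [Fintype ι] (F : ι → V × V) (S : Finset V) : Finset ι :=
  Finset.univ.filter fun i => ¬((F i).1 ∈ S ↔ (F i).2 ∈ S)

lemma sepPairs_inter_terminals [Fintype ι] (F : ι → V × V) (S : Finset V) :
    sepPairs F (S ∩ terminals F) = sepPairs F S := by
  ext i
  simp only [sepPairs, Finset.mem_filter, Finset.mem_univ, true_and, Finset.mem_inter]
  by_cases hne : (F i).1 = (F i).2
  · simp [hne]
  · simp [mem_terminals_of_ne hne]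

lemma card_le_two_pow_card_terminals [Fintype ι] (F : ι → V × V) (𝒬 : Finset (Finset ι))
    (h𝒬 : ∀ P ∈ 𝒬, ∃ S, sepPairs F S = P) : 𝒬.card ≤ 2 ^ (terminals F).card := by
  classical
  rw [← Finset.card_powerset]
  refine (Finset.card_le_card ?_).trans
    (Finset.card_image_le (s := (terminals F).powerset) (f := sepPairs F))
  intro P hP
  obtain ⟨S, rfl⟩ := h𝒬 P hP
  exact Finset.mem_image.2 ⟨S ∩ terminals F, Finset.mem_powerset.2 Finset.inter_subset_right,
    sepPairs_inter_terminals F S⟩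

/-- Contracting `b` into the terminal `a` loses `b` and creates no terminal; pairs that collapse to
loops are ignored. -/
lemma terminals_contract_subset (F : ι → V × V) {a b : V} (ha : a ∈ terminals F) (hab : a ≠ b) :
    terminals (fun i => ((if (F i).1 = b then a else (F i).1),
      (if (F i).2 = b then a else (F i).2))) ⊆ (terminals F).erase b := by
  intro v hv
  obtain ⟨i, hne, hv⟩ := mem_terminals.1 hv
  dsimp only at hne hv
  have hne' : (F i).1 ≠ (F i).2 := fun h => hne (by rw [h])
  obtain ⟨h1, h2⟩ := mem_terminals_of_ne hne'
  rw [Finset.mem_erase]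
  rcases hv with hv | hv <;> split_ifs at hv with h <;> subst hv
  exacts [⟨hab, ha⟩, ⟨h, h1⟩, ⟨hab, ha⟩, ⟨h, h2⟩]

lemma sum_sepInd_singleton_le (u v : V) : ∑ x, sepInd {x} u v ≤ 2 := by
  calc ∑ x, sepInd {x} u v ≤ ∑ x, ((if x = u then 1 else 0) + (if x = v then 1 else 0) : ℝ) := by
        refine Finset.sum_le_sum fun x _ => ?_
        simp only [sepInd, Finset.mem_singleton, eq_comm (a := x)]
        by_cases u = x <;> by_cases v = x <;> simp [*]
    _ = 2 := by rw [Finset.sum_add_distrib]; simp; norm_num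

/-- Each terminal singleton separates a pair, so it has degree at least `K`, and every edge is
counted at its two ends. -/
lemma mul_card_terminals_le (F : ι → V × V) {K : ℝ} {w : V → V → ℝ} (hw : ∀ u v, 0 ≤ w u v)
    (hK : ∀ S, Separates F S → K ≤ cutSum w S) :
    (terminals F).card * K ≤ 2 * ∑ u, ∑ v, w u v := by
  classical
  calc (terminals F).card * K = ∑ x ∈ terminals F, K := by simp
    _ ≤ ∑ x ∈ terminals F, cutSum w {x} := by
        refine Finset.sum_le_sum fun x hx => hK _ ?_
        obtain ⟨i, hne, h⟩ := mem_terminals.1 hx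
        refine ⟨i, fun h' => hne ?_⟩
        simp only [Finset.mem_singleton] at h'
        rcases h with h | h
        · rw [h'.1 h, h]
        · rw [h'.2 h, h]
    _ ≤ ∑ x, cutSum w {x} := Finset.sum_le_sum_of_subset_of_nonneg (Finset.subset_univ _)
        fun x _ _ => cutSum_nonneg hw _
    _ = ∑ u, ∑ v, w u v * ∑ x, sepInd {x} u v := by
        unfold cutSum
        rw [Finset.sum_comm]
        refine Finset.sum_congr rfl fun u _ => ?_
        rw [Finset.sum_comm]
        exact Finset.sum_congr rfl fun v _ => by rw [Finset.mul_sum]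
    _ ≤ ∑ u, ∑ v, w u v * 2 := Finset.sum_le_sum fun u _ => Finset.sum_le_sum fun v _ =>
        mul_le_mul_of_nonneg_left (sum_sepInd_singleton_le u v) (hw u v)
    _ = 2 * ∑ u, ∑ v, w u v := by simp only [← Finset.sum_mul]; ring

/-- With `x = 2 α / r ≤ 1 / 2`, the left factor is at most `exp (-2 x) ≤ 1 / (1 + 2 x) ≤ 1 - x`.
This is the loss in one contraction step, and it dictates the exponent `4 α`. -/
lemma rpow_sub_one_le {α : ℝ} (hα : 0 ≤ α) {r : ℝ} (hr : 1 ≤ r) (h : 4 * α ≤ r) :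
    (r - 1) ^ (4 * α) ≤ r ^ (4 * α) * (1 - 2 * α / r) := by
  have hr0 : 0 < r := by linarith
  set x := 2 * α / r with hx
  have hx0 : 0 ≤ x := by positivity
  have hx1 : x ≤ 1 / 2 := by rw [hx, div_le_iff₀ hr0]; linarith
  have h1 : r - 1 = r * (1 - 1 / r) := by field_simp
  have h2 : 0 ≤ 1 - 1 / r := by
    rw [sub_nonneg, div_le_one hr0]; exact hr
  rw [h1, Real.mul_rpow hr0.le h2]
  refine mul_le_mul_of_nonneg_left ?_ (by positivity)
  calc (1 - 1 / r) ^ (4 * α) ≤ (Real.exp (-(1 / r))) ^ (4 * α) :=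
        Real.rpow_le_rpow h2 (by linarith [Real.add_one_le_exp (-(1 / r))]) (by linarith)
    _ = (Real.exp (2 * x))⁻¹ := by
        rw [← Real.exp_mul, ← Real.exp_neg]; congr 1; rw [hx]; ring
    _ ≤ (2 * x + 1)⁻¹ := inv_anti₀ (by linarith) (Real.add_one_le_exp _)
    _ ≤ 1 - x := by
        rw [inv_le_iff_one_le_mul₀ (by linarith)]
        nlinarith

/-- Counting cut projections: if every cut that separates a pair of `F` has weight at least `K`,
then the cuts of weight at most `α K` have at most `16 ^ α * r ^ (4 α)` distinct projections to
`F`, where `r` bounds the number of terminals. -/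
theorem card_projections_le [Fintype ι] {α K : ℝ} (hα : 1 ≤ α) (hK0 : 0 < K) (r : ℕ) (hr : 1 ≤ r)
    (F : ι → V × V) (w : V → V → ℝ) (hw : ∀ u v, 0 ≤ w u v) (hsymm : ∀ u v, w u v = w v u)
    (hK : ∀ S, Separates F S → K ≤ cutSum w S) (hcard : (terminals F).card ≤ r)
    (𝒬 : Finset (Finset ι)) (h𝒬 : ∀ P ∈ 𝒬, ∃ S, sepPairs F S = P ∧ cutSum w S ≤ α * K) :
    (𝒬.card : ℝ) ≤ 16 ^ α * (r : ℝ) ^ (4 * α) := by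
  induction r, hr using Nat.le_induction generalizing F w 𝒬 with
  | base =>
    have h1 := card_le_two_pow_card_terminals F 𝒬 fun P hP => (h𝒬 P hP).imp fun _ h => h.1
    have h2 : 𝒬.card ≤ 2 ^ 1 := h1.trans (Nat.pow_le_pow_right (by norm_num) hcard)
    calc (𝒬.card : ℝ) ≤ 16 := by exact_mod_cast h2.trans (by norm_num)
      _ ≤ 16 ^ α := Real.self_le_rpow_of_one_le (by norm_num) hα
      _ = 16 ^ α * ((1 : ℕ) : ℝ) ^ (4 * α) := by simp
  | succ r hr ih =>
    have hrpos : (1 : ℝ) ≤ ((r + 1 : ℕ) : ℝ) := by simp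
    -- With few terminals the trivial bound `2 ^ (r + 1) ≤ 2 ^ (4 α) = 16 ^ α` suffices, which is
    -- where 16 comes from.
    by_cases hbig : ((r + 1 : ℕ) : ℝ) ≤ 4 * α
    · have h1 := card_le_two_pow_card_terminals F 𝒬 fun P hP => (h𝒬 P hP).imp fun _ h => h.1
      have h2 : 𝒬.card ≤ 2 ^ (r + 1) := h1.trans (Nat.pow_le_pow_right (by norm_num) hcard)
      calc (𝒬.card : ℝ) ≤ (2 : ℝ) ^ (r + 1) := by exact_mod_cast h2
        _ = (2 : ℝ) ^ ((r + 1 : ℕ) : ℝ) := (Real.rpow_natCast 2 (r + 1)).symm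
        _ ≤ (2 : ℝ) ^ (4 * α) := Real.rpow_le_rpow_of_exponent_le (by norm_num) hbig
        _ = 16 ^ α := by rw [Real.rpow_mul (by norm_num)]; norm_num
        _ ≤ 16 ^ α * ((r + 1 : ℕ) : ℝ) ^ (4 * α) :=
          le_mul_of_one_le_right (by positivity) (Real.one_le_rpow hrpos (by linarith))
    push Not at hbig
    by_cases hlt : (terminals F).card ≤ r
    · refine (ih F w hw hsymm hK hlt 𝒬 h𝒬).trans ?_
      gcongr
      simp
    have hcard' : (terminals F).card = r + 1 := by omega
    obtain ⟨w', h0, hs, hd, hle, hk, hsupp⟩ := exists_splitting_off F K w hw hsymm hK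
    choose! R hR using h𝒬
    set N : ℝ := 16 ^ α * (r : ℝ) ^ (4 * α) with hN
    have hN0 : 0 ≤ N := by positivity
    -- Projections whose chosen cut `R P` leaves `ab` uncut survive the contraction of `b` into `a`,
    -- where induction applies.
    have hcount : ∀ a b, w' a b ≠ 0 →
        ((𝒬.filter fun P => (a ∈ R P ↔ b ∈ R P)).card : ℝ) ≤ N := by
      intro a b hab0
      have hab : a ≠ b := fun h => hab0 (by rw [h]; exact hd b)
      have haT : a ∈ terminals F := by by_contra h; exact hab0 (hsupp a h b)
      have hbT : b ∈ terminals F := by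
        by_contra h; exact hab0 (by rw [hs]; exact hsupp b h a)
      set f : V → V := fun v => if v = b then a else v with hf
      have hsep : ∀ S, Separates (fun i => (f (F i).1, f (F i).2)) S →
          Separates F (Finset.univ.filter fun v => f v ∈ S) := by
        rintro S ⟨i, hi⟩
        exact ⟨i, by simpa using hi⟩
      refine ih (fun i => (f (F i).1, f (F i).2)) (pushWeight f w') (pushWeight_nonneg f h0)
        (pushWeight_symm f hs) (fun S hS => ?_) ?_ _ ?_
      · rw [cutSum_pushWeight]; exact hk _ (hsep S hS)
      · have := Finset.card_le_card (terminals_contract_subset F haT hab)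
        rw [Finset.card_erase_of_mem hbT, hcard'] at this
        exact this
      · intro P hP
        obtain ⟨hP, hsame⟩ := Finset.mem_filter.1 hP
        have hpre : ∀ v, f v ∈ R P ↔ v ∈ R P := by
          intro v
          by_cases hv : v = b
          · simp only [hf, hv, if_true]; exact hsame
          · simp only [hf, hv, if_false]
        refine ⟨R P, Eq.trans ?_ (hR P hP).1, ?_⟩
        · ext i
          simp only [sepPairs, Finset.mem_filter, Finset.mem_univ, true_and, hpre]
        · rw [cutSum_pushWeight]
          have : (Finset.univ.filter fun v => f v ∈ R P) = R P := by ext v; simp [hpre]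
          rw [this]
          exact (hle _).trans (hR P hP).2
    set W := ∑ u, ∑ v, w' u v with hW
    have hWK : ((r + 1 : ℕ) : ℝ) * K ≤ 2 * W := by
      have := mul_card_terminals_le F h0 hk
      rwa [hcard'] at this
    have hWpos : 0 < W := by
      have : 0 < ((r + 1 : ℕ) : ℝ) * K := by positivity
      linarith
    -- Double counting of uncut weight over edges and projections: the average over edges replaces
    -- the random contraction.
    have hdouble : ∑ P ∈ 𝒬, (W - cutSum w' (R P)) ≤ W * N := by
      have h1 : ∑ P ∈ 𝒬, (W - cutSum w' (R P)) =
          ∑ u, ∑ v, w' u v * ∑ P ∈ 𝒬, (1 - sepInd (R P) u v) := by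
        simp only [hW, cutSum, ← Finset.sum_sub_distrib]
        rw [Finset.sum_comm]
        refine Finset.sum_congr rfl fun u _ => ?_
        rw [Finset.sum_comm]
        refine Finset.sum_congr rfl fun v _ => ?_
        rw [Finset.mul_sum]
        exact Finset.sum_congr rfl fun P _ => by ring
      rw [h1, hW, Finset.sum_mul]
      refine Finset.sum_le_sum fun u _ => ?_
      rw [Finset.sum_mul]
      refine Finset.sum_le_sum fun v _ => ?_
      by_cases huv : w' u v = 0
      · simp [huv]
      · refine mul_le_mul_of_nonneg_left (le_trans (le_of_eq ?_) (hcount u v huv)) (h0 u v)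
        rw [Finset.card_filter, Nat.cast_sum]
        refine Finset.sum_congr rfl fun P _ => ?_
        simp only [sepInd]
        split_ifs <;> simp
    have hlow : (𝒬.card : ℝ) * (W * (1 - 2 * α / ((r + 1 : ℕ) : ℝ))) ≤
        ∑ P ∈ 𝒬, (W - cutSum w' (R P)) := by
      rw [← nsmul_eq_mul]
      refine Finset.card_nsmul_le_sum _ _ _ fun P hP => ?_
      have h1 : cutSum w' (R P) ≤ α * K := (hle _).trans (hR P hP).2
      have h2 : α * K ≤ W * (2 * α / ((r + 1 : ℕ) : ℝ)) := by
        rw [mul_div_assoc', le_div_iff₀ (by positivity)]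
        nlinarith
      linarith
    have hfac := rpow_sub_one_le (by linarith : (0 : ℝ) ≤ α) hrpos hbig.le
    have hpos : 0 < 1 - 2 * α / ((r + 1 : ℕ) : ℝ) := by
      rw [sub_pos, div_lt_one (by positivity)]; linarith
    have h3 : (𝒬.card : ℝ) * (1 - 2 * α / ((r + 1 : ℕ) : ℝ)) ≤ N := by
      refine le_of_mul_le_mul_left ?_ hWpos
      calc W * ((𝒬.card : ℝ) * (1 - 2 * α / ((r + 1 : ℕ) : ℝ)))
          = (𝒬.card : ℝ) * (W * (1 - 2 * α / ((r + 1 : ℕ) : ℝ))) := by ring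
        _ ≤ W * N := hlow.trans hdouble
    refine le_of_mul_le_mul_right (h3.trans ?_) hpos
    have h4 : ((r + 1 : ℕ) : ℝ) - 1 = r := by push_cast; ring
    rw [h4] at hfac
    calc N ≤ 16 ^ α * (((r + 1 : ℕ) : ℝ) ^ (4 * α) * (1 - 2 * α / ((r + 1 : ℕ) : ℝ))) :=
          mul_le_mul_of_nonneg_left hfac (by positivity)
      _ = _ := by ring

end WeightedCut

/-! ### Minimally extended cuts and the clique graph. -/

namespace WeightedGraph

variable {V : Type*} [Fintype V] [DecidableEq V]

lemma mem_nbhd (G : WeightedGraph V) {x u : V} : u ∈ G.nbhd x ↔ G.graph.Adj x u := by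
  simp [nbhd]

lemma weight_eq_zero_of_notMem_nbhd (G : WeightedGraph V) {x u : V} (h : u ∉ G.nbhd x) :
    G.weight s(x, u) = 0 :=
  G.weight_eq_zero _ fun h' => h (G.mem_nbhd.2 h')

lemma weightTo_eq_sum (G : WeightedGraph V) (x : V) (S : Finset V) :
    G.weightTo x S = ∑ u ∈ S, G.weight s(x, u) :=
  Finset.sum_subset Finset.inter_subset_left fun _ hu hu' =>
    G.weight_eq_zero_of_notMem_nbhd fun h => hu' (Finset.mem_inter.2 ⟨hu, h⟩)

/-- The contribution `min {w(x, S), w(x, VC \ S)}` of `x` to the minimally extended cut. -/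
noncomputable def starCut (G : WeightedGraph V) (VC : Finset V) (x : V) (S : Finset V) : ℝ :=
  min (G.weightTo x S) (G.weightTo x (VC \ S))

lemma weightTo_nonneg {G : WeightedGraph V} (hw : ∀ e, 0 ≤ G.weight e) (x : V) (S : Finset V) :
    0 ≤ G.weightTo x S :=
  Finset.sum_nonneg fun _ _ => hw _

lemma starCut_nonneg {G : WeightedGraph V} (hw : ∀ e, 0 ≤ G.weight e) (VC : Finset V) (x : V)
    (S : Finset V) : 0 ≤ G.starCut VC x S :=
  le_min (weightTo_nonneg hw _ _) (weightTo_nonneg hw _ _)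

lemma starCut_le {G : WeightedGraph V} (VC : Finset V) {x : V} (S : Finset V) {d : ℕ} {M : ℝ}
    (hM : 0 ≤ M) (hd : (G.nbhd x).card ≤ d) (hwM : ∀ e, G.weight e ≤ M) :
    G.starCut VC x S ≤ d * M := by
  refine (min_le_left _ _).trans ((Finset.sum_le_card_nsmul _ _ M fun u _ => hwM _).trans ?_)
  rw [nsmul_eq_mul]
  have : (S ∩ G.nbhd x).card ≤ d := (Finset.card_le_card Finset.inter_subset_right).trans hd
  gcongr

lemma starCut_empty {G : WeightedGraph V} (hw : ∀ e, 0 ≤ G.weight e) (VC : Finset V) (x : V) :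
    G.starCut VC x ∅ = 0 := by
  unfold starCut
  have h : G.weightTo x ∅ = 0 := by simp [weightTo]
  rw [h]
  exact min_eq_left (weightTo_nonneg hw _ _)

lemma nbhd_subset_of_bipartite {G : WeightedGraph V} {VC : Finset V}
    (hb : G.graph.IsBipartiteWith (VC : Set V) ((VCᶜ : Finset V) : Set V)) {x : V}
    (hx : x ∉ VC) : G.nbhd x ⊆ VC := by
  intro u hu
  rcases hb.mem_of_adj (G.mem_nbhd.1 hu) with h | h
  · exact absurd (by simpa using h.1) hx
  · simpa using h.2

lemma weight_eq_zero_of_mem_of_mem {G : WeightedGraph V} {VC : Finset V}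
    (hb : G.graph.IsBipartiteWith (VC : Set V) ((VCᶜ : Finset V) : Set V)) {u v : V}
    (hu : u ∈ VC) (hv : v ∈ VC) : G.weight s(u, v) = 0 := by
  refine G.weight_eq_zero _ fun h => ?_
  rcases hb.mem_of_adj h with h | h
  · have := h.2; simp_all
  · have := h.1; simp_all

lemma minExtCut_eq_sum_starCut {G : WeightedGraph V} {VC S : Finset V}
    (hb : G.graph.IsBipartiteWith (VC : Set V) ((VCᶜ : Finset V) : Set V)) (hS : S ⊆ VC) :
    G.minExtCut VC S = ∑ x ∈ VCᶜ, G.starCut VC x S := by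
  unfold minExtCut
  rw [Finset.sum_eq_zero fun u hu => Finset.sum_eq_zero fun v hv =>
    weight_eq_zero_of_mem_of_mem hb (hS hu) (Finset.mem_sdiff.1 hv).1, zero_add]
  rfl

lemma lightAndSample_weight (G : WeightedGraph V) (light heads : Finset V) (e : Sym2 V) :
    (G.lightAndSample light heads).weight e =
      ∑ y ∈ light, (if y ∈ e then G.weight e else 0) +
        ∑ y ∈ heads, 2 * (if y ∈ e then G.weight e else 0) := rfl

lemma lightAndSample_weight_mk {G : WeightedGraph V} {VC light heads : Finset V}
    (hl : light ⊆ VCᶜ) (hh : heads ⊆ VCᶜ) {x u : V} (hu : u ∈ VC) :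
    (G.lightAndSample light heads).weight s(x, u) =
      ((if x ∈ light then 1 else 0) + 2 * (if x ∈ heads then 1 else 0)) * G.weight s(x, u) := by
  have key : ∀ T ⊆ VCᶜ, ∀ c : ℝ, ∑ y ∈ T, (if y ∈ s(x, u) then c else 0) =
      if x ∈ T then c else 0 := by
    intro T hT c
    rw [← Finset.sum_ite_eq' T x fun _ => c]
    refine Finset.sum_congr rfl fun y hy => ?_
    have : y ≠ u := fun h => Finset.mem_compl.1 (hT hy) (h ▸ hu)
    simp [this]
  rw [lightAndSample_weight, ← Finset.mul_sum, key _ hl, key _ hh]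
  split_ifs <;> ring

lemma minExtCut_lightAndSample {G : WeightedGraph V} {VC light heads S : Finset V}
    (hb : G.graph.IsBipartiteWith (VC : Set V) ((VCᶜ : Finset V) : Set V))
    (hl : light ⊆ VCᶜ) (hh : heads ⊆ VCᶜ) (hS : S ⊆ VC) :
    (G.lightAndSample light heads).minExtCut VC S =
      ∑ x ∈ VCᶜ, ((if x ∈ light then 1 else 0) + 2 * (if x ∈ heads then 1 else 0)) *
        G.starCut VC x S := by
  unfold minExtCut
  rw [Finset.sum_eq_zero fun u hu => Finset.sum_eq_zero fun v hv => by
    rw [lightAndSample_weight_mk hl hh (Finset.mem_sdiff.1 hv).1,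
      weight_eq_zero_of_mem_of_mem hb (hS hu) (Finset.mem_sdiff.1 hv).1, mul_zero], zero_add]
  refine Finset.sum_congr rfl fun x _ => ?_
  have key : ∀ T ⊆ VC, (G.lightAndSample light heads).weightTo x T =
      ((if x ∈ light then 1 else 0) + 2 * (if x ∈ heads then 1 else 0)) * G.weightTo x T := by
    intro T hT
    rw [weightTo_eq_sum, weightTo_eq_sum, Finset.mul_sum]
    exact Finset.sum_congr rfl fun u hu => lightAndSample_weight_mk hl hh (hT hu)
  rw [key S hS, key _ Finset.sdiff_subset, starCut, mul_min_of_nonneg]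
  split_ifs <;> norm_num

/-- A doubled star overshoots by its contribution, a dropped one undershoots by the same amount, and
light stars cancel. -/
lemma minExtCut_sub_lightAndSample {G : WeightedGraph V} {VC light S : Finset V}
    (hb : G.graph.IsBipartiteWith (VC : Set V) ((VCᶜ : Finset V) : Set V))
    (hl : light ⊆ VCᶜ) (hS : S ⊆ VC) (b : V → Bool) :
    G.minExtCut VC S - (G.lightAndSample light
        ((VCᶜ \ light).filter fun x => b x = true)).minExtCut VC S =
      ∑ x ∈ VCᶜ \ light, G.starCut VC x S * (if b x = true then -1 else 1) := by
  rw [minExtCut_eq_sum_starCut hb hS, minExtCut_lightAndSample hb hl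
    ((Finset.filter_subset _ _).trans Finset.sdiff_subset) hS, ← Finset.sum_sub_distrib,
    ← Finset.sum_sdiff hl]
  rw [Finset.sum_eq_zero (s := light), add_zero]
  · refine Finset.sum_congr rfl fun x hx => ?_
    have hx' := (Finset.mem_sdiff.1 hx).2
    by_cases hbx : b x = true
    · rw [if_neg hx', if_pos (Finset.mem_filter.2 ⟨hx, hbx⟩), if_pos hbx]; ring
    · have hx'' : x ∉ (VCᶜ \ light).filter fun x => b x = true := fun h =>
        hbx (Finset.mem_filter.1 h).2
      rw [if_neg hx', if_neg hx'', if_neg hbx]; ring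
  · intro x hx
    rw [if_pos hx, if_neg fun h => (Finset.mem_sdiff.1 (Finset.mem_filter.1 h).1).2 hx]
    ring

lemma cutWeight_iUnion {ι : Type*} (s : Finset ι) (F : ι → WeightedGraph V) (S : Finset V) :
    (iUnion s F).cutWeight S = ∑ i ∈ s, (F i).cutWeight S := by
  simp only [cutWeight, iUnion]
  rw [Finset.sum_comm]
  simp only [Finset.sum_comm (s := s)]
  rw [Finset.sum_comm]

lemma cutWeight_clique (G : WeightedGraph V) (y : V) (S : Finset V) :
    (G.clique y).cutWeight S =
      G.weightTo y S * G.weightTo y Sᶜ / ∑ i ∈ G.nbhd y, G.weight s(y, i) := by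
  rw [weightTo_eq_sum, weightTo_eq_sum, Finset.sum_mul_sum, Finset.sum_div]
  refine Finset.sum_congr rfl fun u hu => ?_
  rw [Finset.sum_div]
  refine Finset.sum_congr rfl fun v hv => ?_
  have huv : u ≠ v := fun h => Finset.mem_compl.1 hv (h ▸ hu)
  change (if u ≠ v ∧ u ∈ G.nbhd y ∧ v ∈ G.nbhd y then _ else _) = _
  split_ifs with h
  · rfl
  · by_cases hu' : u ∈ G.nbhd y
    · rw [G.weight_eq_zero_of_notMem_nbhd (u := v) fun hv' => h ⟨huv, hu', hv'⟩]; simp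
    · rw [G.weight_eq_zero_of_notMem_nbhd hu']; simp

lemma weightTo_add_weightTo_compl (G : WeightedGraph V) (y : V) (S : Finset V) :
    G.weightTo y S + G.weightTo y Sᶜ = ∑ i ∈ G.nbhd y, G.weight s(y, i) := by
  rw [weightTo_eq_sum, weightTo_eq_sum, Finset.sum_add_sum_compl]
  exact (Finset.sum_subset (Finset.subset_univ _) fun u _ hu =>
    G.weight_eq_zero_of_notMem_nbhd hu).symm

lemma weightTo_compl {G : WeightedGraph V} {VC : Finset V} {y : V} (hy : G.nbhd y ⊆ VC)
    (S : Finset V) : G.weightTo y Sᶜ = G.weightTo y (VC \ S) := by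
  unfold weightTo
  refine Finset.sum_congr ?_ fun _ _ => rfl
  ext u
  simp only [Finset.mem_inter, Finset.mem_compl, Finset.mem_sdiff]
  have := @hy u
  tauto

/-- The clique cut is `a b / (a + b)` with `a`, `b` the weights from `y` to the two sides, hence at
most `min a b`. -/
lemma cutWeight_clique_le {G : WeightedGraph V} (hw : ∀ e, 0 ≤ G.weight e) {VC : Finset V} {y : V}
    (hy : G.nbhd y ⊆ VC) (S : Finset V) : (G.clique y).cutWeight S ≤ G.starCut VC y S := by
  rw [cutWeight_clique, ← weightTo_add_weightTo_compl G y S, starCut, ← weightTo_compl hy]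
  have ha := weightTo_nonneg hw y S
  have hb := weightTo_nonneg hw y Sᶜ
  rcases eq_or_lt_of_le (add_nonneg ha hb) with h | h
  · rw [← h, div_zero]; exact le_min ha hb
  · rw [div_le_iff₀ h]
    refine le_trans ?_ (le_of_eq (mul_comm _ _))
    rcases le_total (G.weightTo y S) (G.weightTo y Sᶜ) with h' | h'
    · rw [min_eq_left h']; nlinarith
    · rw [min_eq_right h']; nlinarith

lemma clique_weight_nonneg {G : WeightedGraph V} (hw : ∀ e, 0 ≤ G.weight e) (y : V) (e : Sym2 V) :
    0 ≤ (G.clique y).weight e := by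
  induction e with
  | _ u v =>
    change 0 ≤ (if u ≠ v ∧ u ∈ G.nbhd y ∧ v ∈ G.nbhd y then _ else _)
    split_ifs
    · exact div_nonneg (mul_nonneg (hw _) (hw _)) (Finset.sum_nonneg fun _ _ => hw _)
    · exact le_rfl

lemma cutSum_weight (G : WeightedGraph V) (S : Finset V) :
    WeightedCut.cutSum (fun u v => G.weight s(u, v)) S = 2 * G.cutWeight S := by
  have h1 : ∀ u v, G.weight s(u, v) * WeightedCut.sepInd S u v =
      (if u ∈ S then if v ∈ Sᶜ then G.weight s(u, v) else 0 else 0) +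
      (if v ∈ S then if u ∈ Sᶜ then G.weight s(v, u) else 0 else 0) := by
    intro u v
    rw [Sym2.eq_swap (a := v)]
    simp only [WeightedCut.sepInd, Finset.mem_compl]
    by_cases u ∈ S <;> by_cases v ∈ S <;> simp [*]
  have h2 : ∑ u, ∑ v, (if u ∈ S then if v ∈ Sᶜ then G.weight s(u, v) else 0 else 0) =
      G.cutWeight S := by
    have h : ∀ u, ∑ v, (if u ∈ S then if v ∈ Sᶜ then G.weight s(u, v) else 0 else 0) =
        if u ∈ S then ∑ v ∈ Sᶜ, G.weight s(u, v) else 0 := by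
      intro u
      split_ifs
      · rw [Finset.sum_ite_mem, Finset.univ_inter]
      · simp
    simp only [h]
    rw [Finset.sum_ite_mem, Finset.univ_inter, cutWeight]
  unfold WeightedCut.cutSum
  simp only [h1, Finset.sum_add_distrib]
  rw [h2, Finset.sum_comm, h2]
  ring

/-- The pairs of vertices with a common neighbor in `T`; all other pairs are replaced by loops. -/
noncomputable def coneighborPairs (G : WeightedGraph V) (T : Finset V) (p : V × V) : V × V :=
  open Classical in
  if ∃ x ∈ T, p.1 ∈ G.nbhd x ∧ p.2 ∈ G.nbhd x then p else (p.1, p.1)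

/-- The separated pairs inside `N(x)` determine the trace of `S` on `N(x)` up to complement, and the
minimum is symmetric in the two sides. -/
lemma starCut_eq_of_sepPairs_eq {G : WeightedGraph V} {T VC S S' : Finset V} {x : V} (hx : x ∈ T)
    (hxVC : G.nbhd x ⊆ VC)
    (h : WeightedCut.sepPairs (G.coneighborPairs T) S =
      WeightedCut.sepPairs (G.coneighborPairs T) S') :
    G.starCut VC x S = G.starCut VC x S' := by
  have key : ∀ u ∈ G.nbhd x, ∀ v ∈ G.nbhd x, ((u ∈ S ↔ v ∈ S) ↔ (u ∈ S' ↔ v ∈ S')) := by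
    intro u hu v hv
    have hF : G.coneighborPairs T (u, v) = (u, v) := if_pos ⟨x, hx, hu, hv⟩
    have := Finset.ext_iff.1 h (u, v)
    simp only [WeightedCut.sepPairs, Finset.mem_filter, Finset.mem_univ, true_and, hF] at this
    exact not_iff_not.1 this
  have hcongr : ∀ A B : Finset V, (∀ u ∈ G.nbhd x, (u ∈ A ↔ u ∈ B)) →
      G.weightTo x A = G.weightTo x B := by
    intro A B hAB
    unfold weightTo
    refine Finset.sum_congr ?_ fun _ _ => rfl
    ext u
    simp only [Finset.mem_inter]
    exact and_congr_left (hAB u)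
  unfold starCut
  by_cases hsame : ∀ u ∈ G.nbhd x, (u ∈ S ↔ u ∈ S')
  · rw [hcongr S S' hsame, hcongr (VC \ S) (VC \ S') fun u hu => by
      simp only [Finset.mem_sdiff, hsame u hu]]
  · push Not at hsame
    obtain ⟨u, hu, hne⟩ := hsame
    have hopp : ∀ v ∈ G.nbhd x, (v ∈ S ↔ v ∉ S') := by
      intro v hv
      have := key u hu v hv
      tauto
    rw [hcongr S (VC \ S') fun v hv => by
        simp only [Finset.mem_sdiff, hxVC hv, true_and, hopp v hv],
      hcongr (VC \ S) S' fun v hv => by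
        simp only [Finset.mem_sdiff, hxVC hv, true_and, hopp v hv, not_not], min_comm]

lemma le_cutSum_of_separates {G : WeightedGraph V} {VC T : Finset V} {k : ℝ}
    (hheavy : G.IsHeavySubset VC T k) {S : Finset V}
    (hS : WeightedCut.Separates (G.coneighborPairs T) S) :
    2 * k ≤ WeightedCut.cutSum (fun u v => (iUnion (VCᶜ \ T) G.clique).weight s(u, v)) S := by
  obtain ⟨⟨u, v⟩, hi⟩ := hS
  unfold coneighborPairs at hi
  split_ifs at hi with hx
  · obtain ⟨x, hx, hu, hv⟩ := hx
    have hne : u ≠ v := by rintro rfl; exact hi Iff.rfl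
    have hor : ∀ a ∈ G.nbhd x, ∀ b ∈ G.nbhd x, a ≠ b → a ∈ S → b ∉ S →
        2 * k ≤ WeightedCut.cutSum (fun u v => (iUnion (VCᶜ \ T) G.clique).weight s(u, v)) S := by
      intro a ha b hb hab haS hbS
      rw [cutSum_weight]
      linarith [hheavy.2 x hx a ha b hb hab S haS hbS]
    by_cases huS : u ∈ S
    · exact hor u hu v hv hne huS fun hvS => hi (by simp [huS, hvS])
    · have hvS : v ∈ S := by by_contra hvS; exact hi (by simp [huS, hvS])
      exact hor v hv u hu hne.symm hvS huS
  · exact absurd Iff.rfl hi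

lemma cutSum_clique_le {G : WeightedGraph V} {VC T : Finset V} (hw : ∀ e, 0 ≤ G.weight e)
    (hb : G.graph.IsBipartiteWith (VC : Set V) ((VCᶜ : Finset V) : Set V))
    {S : Finset V} (hS : S ⊆ VC) :
    WeightedCut.cutSum (fun u v => (iUnion (VCᶜ \ T) G.clique).weight s(u, v)) S ≤
      2 * G.minExtCut VC S := by
  rw [cutSum_weight, cutWeight_iUnion, minExtCut_eq_sum_starCut hb hS]
  refine mul_le_mul_of_nonneg_left ?_ (by norm_num)
  refine (Finset.sum_le_sum fun y hy => cutWeight_clique_le hw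
    (nbhd_subset_of_bipartite hb (Finset.mem_compl.1 (Finset.mem_sdiff.1 hy).1)) S).trans ?_
  exact Finset.sum_le_sum_of_subset_of_nonneg Finset.sdiff_subset
    fun x _ _ => starCut_nonneg hw _ _ _

end WeightedGraph

/-! ### Concentration of signed sums. -/

/-- Hoeffding's inequality for a linear combination of independent random signs. -/
theorem measureReal_le_abs_sum_mul_sign_le {ι Ω : Type*} [Fintype ι] [MeasurableSpace Ω]
    {P : Measure Ω} [IsProbabilityMeasure P] {coin : ι → Ω → Bool}
    (hmeas : ∀ i, Measurable (coin i)) (hindep : iIndepFun coin P)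
    (hfair : ∀ i, P {ω | coin i ω = true} = 1 / 2) (a : ι → ℝ) {s B : ℝ} (hs : 0 < s)
    (hB : ∑ i, a i ^ 2 ≤ B) :
    P.real {ω | s ≤ |∑ i, a i * (if coin i ω = true then -1 else 1)|} ≤
      2 * Real.exp (-s ^ 2 / (2 * B)) := by
  -- If all coefficients vanish the event is empty as `s > 0`; otherwise the variance is positive
  -- and may be enlarged to `B` in the denominator.
  rcases eq_or_lt_of_le (Finset.sum_nonneg fun i (_ : i ∈ Finset.univ) => sq_nonneg (a i))
    with h0 | h0
  · have ha : ∀ i, a i = 0 := fun i => by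
      have := (Finset.sum_eq_zero_iff_of_nonneg fun i _ => sq_nonneg (a i)).1 h0.symm i
        (Finset.mem_univ i)
      exact pow_eq_zero_iff (two_ne_zero) |>.1 this
    have : {ω | s ≤ |∑ i, a i * (if coin i ω = true then -1 else 1)|} = ∅ := by
      ext ω
      simp [ha, hs]
    rw [this]
    simp only [measureReal_empty]
    positivity
  have main : ∀ a : ι → ℝ, 0 < ∑ i, a i ^ 2 → ∑ i, a i ^ 2 ≤ B →
      P.real {ω | s ≤ ∑ i, a i * (if coin i ω = true then -1 else 1)} ≤
        Real.exp (-s ^ 2 / (2 * B)) := by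
    intro a ha hB
    set g : ι → Bool → ℝ := fun i b => a i * (if b = true then -1 else 1) with hg
    have hgm : ∀ i, Measurable (g i) := fun i => measurable_of_finite _
    have hint : ∀ i, ∫ ω, g i (coin i ω) ∂P = 0 := by
      intro i
      have hA : MeasurableSet {ω | coin i ω = true} := hmeas i (measurableSet_singleton true)
      have hrw : ∀ ω, g i (coin i ω) =
          a i - Set.indicator {ω | coin i ω = true} (fun _ => 2 * a i) ω := by
        intro ω
        by_cases h : coin i ω = true
        · rw [Set.indicator_of_mem (show ω ∈ {ω | coin i ω = true} from h)]
          simp only [hg, h, if_true]; ring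
        · rw [Set.indicator_of_notMem (show ω ∉ {ω | coin i ω = true} from h)]
          simp only [hg, h]; simp
      simp only [hrw]
      rw [integral_sub (integrable_const _) ((integrable_const _).indicator hA),
        integral_indicator_const _ hA]
      simp [measureReal_def, hfair]
    have hsub : ∀ i, HasSubgaussianMGF (fun ω => g i (coin i ω))
        ((‖|a i| - -|a i|‖₊ / 2) ^ 2) P := by
      intro i
      refine hasSubgaussianMGF_of_mem_Icc_of_integral_eq_zero
        ((hgm i).comp (hmeas i)).aemeasurable (ae_of_all _ fun ω => ?_) (hint i)
      simp only [hg]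
      split_ifs
      · rw [mul_neg_one]; exact ⟨neg_le_neg (le_abs_self _), neg_le_abs _⟩
      · rw [mul_one]; exact ⟨neg_abs_le _, le_abs_self _⟩
    have hH := HasSubgaussianMGF.measure_sum_ge_le_of_iIndepFun (s := Finset.univ)
      (hindep.comp g hgm) (fun i _ => hsub i) hs.le
    have hc : ((∑ i, (‖|a i| - -|a i|‖₊ / 2) ^ 2 : NNReal) : ℝ) = ∑ i, a i ^ 2 := by
      push_cast
      refine Finset.sum_congr rfl fun i _ => ?_
      rw [Real.norm_eq_abs, sub_neg_eq_add, ← two_mul, abs_mul, abs_abs]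
      norm_num
    rw [hc] at hH
    refine hH.trans (Real.exp_le_exp.2 ?_)
    rw [neg_div, neg_div, neg_le_neg_iff]
    gcongr
  have hneg := main (fun i => - a i) (by simpa using h0) (by simpa using hB)
  have hpos := main a h0 hB
  have hsubset : {ω | s ≤ |∑ i, a i * (if coin i ω = true then -1 else 1)|} ⊆
      {ω | s ≤ ∑ i, a i * (if coin i ω = true then -1 else 1)} ∪
        {ω | s ≤ ∑ i, -a i * (if coin i ω = true then -1 else 1)} := by
    intro ω hω
    rcases le_abs.1 (show s ≤ |_| from hω) with h | h
    · exact Or.inl h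
    · refine Or.inr ?_
      show s ≤ ∑ i, -a i * (if coin i ω = true then -1 else 1)
      simpa only [neg_mul, Finset.sum_neg_distrib] using h
  have h1 := measureReal_mono (μ := P) hsubset
  have h2 := measureReal_union_le (μ := P)
    {ω | s ≤ ∑ i, a i * (if coin i ω = true then -1 else 1)}
    {ω | s ≤ ∑ i, -a i * (if coin i ω = true then -1 else 1)}
  linarith

/-! ### Union bound over weight levels and projections. -/

namespace WeightedGraph

lemma sum_range_half_pow_le_one (J : ℕ) : ∑ j ∈ Finset.range J, ((1 : ℝ) / 2) ^ (j + 1) ≤ 1 := by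
  have h : ∑ j ∈ Finset.range J, ((1 : ℝ) / 2) ^ (j + 1) = 1 - (1 / 2) ^ J := by
    induction J with
    | zero => simp
    | succ J ih => rw [Finset.sum_range_succ, ih]; ring
  rw [h]
  linarith [pow_nonneg (by norm_num : (0 : ℝ) ≤ 1 / 2) J]

/-- The number of projections at level `m` times the failure probability of each of them. -/
lemma count_mul_tail_le {n c s m : ℝ} (hn : 2 ≤ n) (hc : 1 ≤ c) (hm : 1 ≤ m)
    (hs : 4 * (18 + c) * Real.log n ≤ s) :
    16 ^ (2 * m) * n ^ (4 * (2 * m)) * (2 * Real.exp (-(s * m) / 4)) ≤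
      n ^ (-c) * (1 / 2) ^ m := by
  have hn0 : 0 < n := by linarith
  have hlog : Real.log 2 ≤ Real.log n := Real.log_le_log (by norm_num) hn
  have hlog2 : 0 < Real.log 2 := Real.log_pos (by norm_num)
  have h16 : (16 : ℝ) = Real.exp (4 * Real.log 2) := by
    rw [show (4 : ℝ) * Real.log 2 = ((4 : ℕ) : ℝ) * Real.log 2 by norm_num, ← Real.log_pow,
      Real.exp_log (by norm_num)]
    norm_num
  have hhalf : (1 / 2 : ℝ) = Real.exp (-Real.log 2) := by
    rw [Real.exp_neg, Real.exp_log (by norm_num)]; norm_num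
  have h2 : (2 : ℝ) * Real.exp (-(s * m) / 4) = Real.exp (Real.log 2 + -(s * m) / 4) := by
    rw [Real.exp_add, Real.exp_log (by norm_num)]
  rw [h2, h16, hhalf, ← Real.exp_mul, ← Real.exp_mul, Real.rpow_def_of_pos hn0,
    Real.rpow_def_of_pos hn0, ← Real.exp_add, ← Real.exp_add, ← Real.exp_add, Real.exp_le_exp]
  -- The budget is 18 = 8 + 8 + 1 + 1: the powers of 16 and of `n`, the factor 2 of the tail, and
  -- the factor `(1 / 2) ^ m`.
  have h3 : 4 * (18 + c) * Real.log n * m ≤ s * m := mul_le_mul_of_nonneg_right hs (by linarith)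
  have h4 : Real.log 2 * m ≤ Real.log n * m := mul_le_mul_of_nonneg_right hlog (by linarith)
  have h5 : Real.log n * c ≤ Real.log n * c * m :=
    le_mul_of_one_le_right (mul_nonneg (by linarith) (by linarith)) hm
  have h6 : Real.log 2 ≤ Real.log 2 * m := le_mul_of_one_le_right hlog2.le hm
  nlinarith

variable {V : Type*} [Fintype V] [DecidableEq V]

/-- Sampling the stars of a heavy set preserves all minimally extended cuts with high probability,
in the nondegenerate case of a positive minimum weight. -/
theorem measureReal_forall_abs_sub_le {G : WeightedGraph V} {VC light : Finset V} {d : ℕ}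
    {γ U ε t c : ℝ} {Ω : Type*} [MeasurableSpace Ω] {P : Measure Ω} [IsProbabilityMeasure P]
    {coin : V → Ω → Bool} (hc : 1 ≤ c) (hn : 2 ≤ Fintype.card V)
    (hb : G.graph.IsBipartiteWith (VC : Set V) ((VCᶜ : Finset V) : Set V))
    (hd : ∀ x ∈ VCᶜ, (G.nbhd x).card ≤ d) (hγ : 0 < γ) (hd1 : 1 ≤ d) (hU : 1 ≤ U)
    (hw : ∀ e, 0 ≤ G.weight e) (hwU : ∀ e, G.weight e ≤ U * γ) (hε : 0 < ε)
    (ht : 4 * (18 + c) * Real.log (Fintype.card V) ≤ ε ^ 2 * t) (hl : light ⊆ VCᶜ)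
    (hheavy : G.IsHeavySubset VC (VCᶜ \ light) (γ * (d * U) * t))
    (hmeas : ∀ x ∈ VCᶜ \ light, Measurable (coin x))
    (hindep : iIndepFun (fun x : {x // x ∈ VCᶜ \ light} => coin x) P)
    (hfair : ∀ x ∈ VCᶜ \ light, P {ω | coin x ω = true} = 1 / 2) :
    1 - (Fintype.card V : ℝ) ^ (-c) ≤
      P.real {ω | ∀ S ⊆ VC,
        |G.minExtCut VC S - (G.lightAndSample light
            ((VCᶜ \ light).filter fun x => coin x ω = true)).minExtCut VC S| ≤
          ε * G.minExtCut VC S} := by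
  classical
  set n : ℝ := (Fintype.card V : ℝ) with hnn
  have hn2 : (2 : ℝ) ≤ n := by rw [hnn]; exact_mod_cast hn
  have hlogn : 0 < Real.log n := Real.log_pos (by linarith)
  have ht0 : 0 < t := by
    have : 0 < ε ^ 2 * t := lt_of_lt_of_le (by positivity) ht
    exact pos_of_mul_pos_right this (by positivity)
  have hd1' : (1 : ℝ) ≤ d := by exact_mod_cast hd1
  set D : ℝ := γ * (d * U) with hD
  have hD0 : 0 < D := by positivity
  set k : ℝ := D * t with hk
  have hk0 : 0 < k := by positivity
  set T := VCᶜ \ light with hT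
  have hTVC : ∀ x ∈ T, G.nbhd x ⊆ VC := fun x hx =>
    nbhd_subset_of_bipartite hb (Finset.mem_compl.1 (Finset.mem_sdiff.1 hx).1)
  set F := G.coneighborPairs T with hF
  set w : V → V → ℝ := fun u v => (iUnion (VCᶜ \ T) G.clique).weight s(u, v) with hwdef
  have hw0 : ∀ u v, 0 ≤ w u v := fun u v =>
    Finset.sum_nonneg fun y _ => clique_weight_nonneg hw y _
  have hws : ∀ u v, w u v = w v u := fun u v => by simp only [hwdef, Sym2.eq_swap]
  have hK : ∀ S, WeightedCut.Separates F S → 2 * k ≤ WeightedCut.cutSum w S :=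
    fun S hS => le_cutSum_of_separates hheavy hS
  have hcut : ∀ S ⊆ VC, WeightedCut.cutSum w S ≤ 2 * G.minExtCut VC S :=
    fun S hS => cutSum_clique_le hw hb hS
  set Z : Finset V → Ω → ℝ := fun S ω =>
    ∑ x : {x // x ∈ T}, G.starCut VC x S * (if coin x ω = true then -1 else 1) with hZ
  have hZeq : ∀ S ⊆ VC, ∀ ω, G.minExtCut VC S - (G.lightAndSample light
      (T.filter fun x => coin x ω = true)).minExtCut VC S = Z S ω := by
    intro S hS ω
    rw [minExtCut_sub_lightAndSample hb hl hS fun x => coin x ω]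
    exact (Finset.sum_coe_sort T
      fun x => G.starCut VC x S * (if coin x ω = true then (-1 : ℝ) else 1)).symm
  have hZproj : ∀ S S', WeightedCut.sepPairs F S = WeightedCut.sepPairs F S' → Z S = Z S' := by
    intro S S' h
    funext ω
    exact Finset.sum_congr rfl fun x _ => by
      rw [starCut_eq_of_sepPairs_eq x.2 (hTVC x x.2) h]
  have hZ0 : ∀ ω, Z ∅ ω = 0 := fun ω => by simp [hZ, starCut_empty hw]
  have htail : ∀ S ⊆ VC, ∀ m : ℝ, 1 ≤ m → G.minExtCut VC S ≤ 2 * m * k →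
      P.real {ω | ε * (m * k) ≤ |Z S ω|} ≤ 2 * Real.exp (-(ε ^ 2 * t * m) / 4) := by
    intro S hS m hm hSm
    -- Every contribution is at most `D`, so the sum of squares is at most `D` times the sum, and
    -- not just the number of stars times `D ^ 2`.
    have hsq : ∑ x : {x // x ∈ T}, G.starCut VC x S ^ 2 ≤ D * (2 * m * k) := by
      rw [Finset.sum_coe_sort T fun x => G.starCut VC x S ^ 2]
      calc ∑ x ∈ T, G.starCut VC x S ^ 2 ≤ ∑ x ∈ T, D * G.starCut VC x S := by
            refine Finset.sum_le_sum fun x hx => ?_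
            rw [sq]
            refine mul_le_mul_of_nonneg_right ?_ (starCut_nonneg hw _ _ _)
            refine (starCut_le VC S (by positivity)
              (hd x (Finset.mem_sdiff.1 hx).1) hwU).trans (le_of_eq ?_)
            rw [hD]; ring
        _ ≤ ∑ x ∈ VCᶜ, D * G.starCut VC x S :=
            Finset.sum_le_sum_of_subset_of_nonneg Finset.sdiff_subset
              fun x _ _ => mul_nonneg hD0.le (starCut_nonneg hw _ _ _)
        _ = D * G.minExtCut VC S := by rw [minExtCut_eq_sum_starCut hb hS, Finset.mul_sum]
        _ ≤ D * (2 * m * k) := by gcongr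
    refine (measureReal_le_abs_sum_mul_sign_le (fun x : {x // x ∈ T} => hmeas x x.2) hindep
      (fun x => hfair x x.2) (fun x => G.starCut VC x S) (by positivity) hsq).trans
      (le_of_eq ?_)
    congr 2
    rw [hk]
    field_simp
    ring
  -- Levels are indexed by `m = j + 1`, since a separating cut has `Δ ≥ k`. They grow arithmetically
  -- and may overlap; the failure probabilities still sum geometrically.
  set Q : ℕ → Finset (Finset V) := fun j => VC.powerset.filter fun S =>
    ((j + 1 : ℕ) : ℝ) * k ≤ G.minExtCut VC S ∧ G.minExtCut VC S ≤ 2 * ((j + 1 : ℕ) : ℝ) * k with hQ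
  set 𝒬 : ℕ → Finset (Finset (V × V)) := fun j => (Q j).image (WeightedCut.sepPairs F) with h𝒬
  have hrep : ∀ j, ∀ p ∈ 𝒬 j, ∃ S, S ∈ Q j ∧ WeightedCut.sepPairs F S = p :=
    fun j p hp => Finset.mem_image.1 hp
  choose! R hR using hrep
  have hcount : ∀ j, ((𝒬 j).card : ℝ) ≤
      16 ^ (2 * ((j + 1 : ℕ) : ℝ)) * n ^ (4 * (2 * ((j + 1 : ℕ) : ℝ))) := by
    intro j
    have hj : (1 : ℝ) ≤ ((j + 1 : ℕ) : ℝ) := by simp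
    -- `K = 2 * k` because `cutSum` counts each edge in both orders; `α = 2 (j + 1)` is the upper
    -- end of the level.
    refine WeightedCut.card_projections_le (K := 2 * k) (by linarith) (by positivity)
      (Fintype.card V) (by omega) F w hw0 hws hK (Finset.card_le_univ _) (𝒬 j) fun p hp => ?_
    obtain ⟨hRQ, hRp⟩ := hR j p hp
    obtain ⟨hRVC, -, hRu⟩ := Finset.mem_filter.1 hRQ
    refine ⟨R j p, hRp, (hcut _ (Finset.mem_powerset.1 hRVC)).trans ?_⟩
    linarith
  set J : ℕ := VC.powerset.sup fun S => ⌊G.minExtCut VC S / k⌋₊ with hJ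
  set bad : Set Ω := ⋃ j ∈ Finset.range J, ⋃ p ∈ 𝒬 j,
    {ω | ε * (((j + 1 : ℕ) : ℝ) * k) ≤ |Z (R j p) ω|} with hbad
  have hbadP : P.real bad ≤ n ^ (-c) := by
    calc P.real bad ≤ ∑ j ∈ Finset.range J, ∑ p ∈ 𝒬 j,
          P.real {ω | ε * (((j + 1 : ℕ) : ℝ) * k) ≤ |Z (R j p) ω|} :=
          (measureReal_biUnion_finset_le _ _).trans
            (Finset.sum_le_sum fun j _ => measureReal_biUnion_finset_le _ _)
      _ ≤ ∑ j ∈ Finset.range J, n ^ (-c) * (1 / 2) ^ (j + 1) := by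
          refine Finset.sum_le_sum fun j _ => ?_
          have hj : (1 : ℝ) ≤ ((j + 1 : ℕ) : ℝ) := by simp
          refine (Finset.sum_le_card_nsmul _ _
            (2 * Real.exp (-(ε ^ 2 * t * ((j + 1 : ℕ) : ℝ)) / 4)) fun p hp => ?_).trans ?_
          · obtain ⟨hRVC, -, hRu⟩ := Finset.mem_filter.1 (hR j p hp).1
            exact htail _ (Finset.mem_powerset.1 hRVC) _ hj hRu
          · rw [nsmul_eq_mul, ← Real.rpow_natCast (1 / 2 : ℝ) (j + 1)]
            exact (mul_le_mul_of_nonneg_right (hcount j) (by positivity)).trans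
              (count_mul_tail_le hn2 hc hj ht)
      _ = n ^ (-c) * ∑ j ∈ Finset.range J, (1 / 2) ^ (j + 1) := by rw [Finset.mul_sum]
      _ ≤ n ^ (-c) * 1 := by
          gcongr
          exact sum_range_half_pow_le_one J
      _ = n ^ (-c) := mul_one _
  -- Covering the whole space lets subadditivity bound the good event from below without its
  -- measurability.
  have hcover : Set.univ ⊆ {ω | ∀ S ⊆ VC, |G.minExtCut VC S - (G.lightAndSample light
      (T.filter fun x => coin x ω = true)).minExtCut VC S| ≤ ε * G.minExtCut VC S} ∪ bad := by
    intro ω _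
    by_contra hω
    rw [Set.mem_union, not_or] at hω
    obtain ⟨hω, hnbad⟩ := hω
    rw [Set.mem_ofPred_eq] at hω
    push Not at hω
    obtain ⟨S, hS, hlt⟩ := hω
    rw [hZeq S hS] at hlt
    have hΔ0 : 0 ≤ G.minExtCut VC S := by
      rw [minExtCut_eq_sum_starCut hb hS]
      exact Finset.sum_nonneg fun x _ => starCut_nonneg hw _ _ _
    have hsep : WeightedCut.Separates F S := by
      -- A cut separating no pair has the projection of `∅`, for which the deviation is zero.
      by_contra hns
      have : WeightedCut.sepPairs F S = WeightedCut.sepPairs F ∅ := by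
        simp only [WeightedCut.Separates, not_exists, not_not] at hns
        ext i
        simp [WeightedCut.sepPairs, hns i]
      rw [hZproj S ∅ this, hZ0, abs_zero] at hlt
      exact absurd hlt (not_lt.2 (mul_nonneg hε.le hΔ0))
    have hkΔ : k ≤ G.minExtCut VC S := by linarith [hK S hsep, hcut S hS]
    have hfloor1 : 1 ≤ ⌊G.minExtCut VC S / k⌋₊ := by
      rw [Nat.one_le_floor_iff, le_div_iff₀ hk0, one_mul]; exact hkΔ
    obtain ⟨j, hj⟩ := Nat.exists_eq_add_of_le' hfloor1
    have hle : ((j + 1 : ℕ) : ℝ) * k ≤ G.minExtCut VC S := by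
      rw [← hj, ← le_div_iff₀ hk0]
      exact Nat.floor_le (by positivity)
    have hge : G.minExtCut VC S ≤ 2 * ((j + 1 : ℕ) : ℝ) * k := by
      have h1 := Nat.lt_floor_add_one (G.minExtCut VC S / k)
      rw [hj, div_lt_iff₀ hk0] at h1
      have h2 : (1 : ℝ) ≤ ((j + 1 : ℕ) : ℝ) := by simp
      nlinarith
    have hSQ : S ∈ Q j := Finset.mem_filter.2 ⟨Finset.mem_powerset.2 hS, hle, hge⟩
    have hp : WeightedCut.sepPairs F S ∈ 𝒬 j := Finset.mem_image_of_mem _ hSQ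
    have hjJ : j ∈ Finset.range J := by
      rw [Finset.mem_range]
      have := Finset.le_sup (f := fun S => ⌊G.minExtCut VC S / k⌋₊) (Finset.mem_powerset.2 hS)
      rw [← hJ] at this
      simp only [hj] at this
      omega
    refine hnbad (Set.mem_biUnion hjJ (Set.mem_biUnion hp ?_))
    rw [Set.mem_ofPred_eq, hZproj _ _ (hR j _ hp).2]
    exact (mul_le_mul_of_nonneg_left hle hε.le).trans hlt.le
  have h1 := (measureReal_mono (μ := P) hcover).trans (measureReal_union_le _ _)
  rw [probReal_univ] at h1
  linarith

end WeightedGraph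

/-! ### The main theorem and its degenerate cases. -/

theorem mainTheorem8 (A c₁ c₂ : ℝ) (hc₂ : 1 ≤ c₂) :
    ∃ C : ℝ, 0 < C ∧
      ∀ {V : Type*} [Fintype V] [DecidableEq V]
        (G : WeightedGraph V) (VC : Finset V) (d : ℕ) (γ U ε t : ℝ) (light : Finset V)
        {Ω : Type*} [MeasurableSpace Ω] (P : Measure Ω) [IsProbabilityMeasure P]
        (coin : V → Ω → Bool),
        -- `G` is bipartite between `VC` and `X = V \ VC`, and `X` has maximum degree `d`
        G.graph.IsBipartiteWith (VC : Set V) ((VCᶜ : Finset V) : Set V) →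
        (∀ x ∈ VCᶜ, (G.nbhd x).card ≤ d) →
        -- the edge weights are in `[γ, U γ]`, and `U` is polynomially bounded
        0 ≤ γ →
        (∀ e ∈ G.graph.edgeSet, γ ≤ G.weight e ∧ G.weight e ≤ U * γ) →
        U ≤ A * (Fintype.card V : ℝ) ^ c₁ →
        0 < ε →
        C * (d * U * Real.log (Fintype.card V) / ε ^ 2) ≤ t →
        -- `X \ light` is a heavy subset
        light ⊆ VCᶜ →
        G.IsHeavySubset VC (VCᶜ \ light) (γ * (d * U) * t) →
        -- independent fair coins, one for every heavy vertex
        (∀ x ∈ VCᶜ \ light, Measurable (coin x)) →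
        iIndepFun (fun x : {x // x ∈ VCᶜ \ light} => coin x) P →
        (∀ x ∈ VCᶜ \ light, P {ω | coin x ω = true} = 1 / 2) →
        1 - (Fintype.card V : ℝ) ^ (-c₂) ≤
          P.real {ω | ∀ S ⊆ VC,
            |G.minExtCut VC S -
                (G.lightAndSample light
                  ((VCᶜ \ light).filter fun x => coin x ω = true)).minExtCut VC S| ≤
              ε * G.minExtCut VC S} := by
  refine ⟨4 * (18 + c₂), by linarith, ?_⟩
  intro V _ _ G VC d γ U ε t light Ω _ P _ coin hb hd hγ hwt _ hε ht hl hheavy hmeas hindep hfair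
  -- An edge with `γ > 0` forces `U ≥ 1`, `d ≥ 1` and `n ≥ 2`; otherwise all weights vanish and the
  -- event is certain.
  by_cases hpos : ∃ e ∈ G.graph.edgeSet, 0 < γ
  · obtain ⟨e, he, hγ0⟩ := hpos
    have hU : 1 ≤ U := by
      have := (hwt e he).1.trans (hwt e he).2
      exact le_of_mul_le_mul_right (by linarith) hγ0
    have hw : ∀ e, 0 ≤ G.weight e := fun e => by
      by_cases h : e ∈ G.graph.edgeSet
      · exact hγ.trans (hwt e h).1
      · rw [G.weight_eq_zero e h]
    have hwU : ∀ e, G.weight e ≤ U * γ := fun e => by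
      by_cases h : e ∈ G.graph.edgeSet
      · exact (hwt e h).2
      · rw [G.weight_eq_zero e h]; positivity
    obtain ⟨x, u, hx, hxu⟩ : ∃ x u, x ∈ VCᶜ ∧ G.graph.Adj x u := by
      induction e with
      | _ u v =>
        rcases hb.mem_of_adj he with h | h
        · exact ⟨v, u, by simpa using h.2, SimpleGraph.Adj.symm he⟩
        · exact ⟨u, v, by simpa using h.1, he⟩
    have hd1 : 1 ≤ d :=
      (Finset.card_pos.2 ⟨u, G.mem_nbhd.2 hxu⟩).trans_le (hd x hx)
    have hn : 2 ≤ Fintype.card V := Fintype.one_lt_card_iff.2 ⟨x, u, hxu.ne⟩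
    have hlog : 0 ≤ Real.log (Fintype.card V) := Real.log_natCast_nonneg _
    have hdU : (1 : ℝ) ≤ d * U := one_le_mul_of_one_le_of_one_le (by exact_mod_cast hd1) hU
    refine G.measureReal_forall_abs_sub_le hc₂ hn hb hd hγ0 hd1 hU hw hwU hε ?_ hl hheavy hmeas
      hindep hfair
    rw [mul_div_assoc', div_le_iff₀ (by positivity)] at ht
    -- As `d U ≥ 1`, the bound on `t` yields `C log n ≤ ε² t`; the factor `d U` needed for
    -- concentration already sits in the heaviness threshold.
    have : Real.log (Fintype.card V) ≤ d * U * Real.log (Fintype.card V) :=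
      le_mul_of_one_le_left hlog hdU
    nlinarith
  · have hw : ∀ e, G.weight e = 0 := fun e => by
      by_cases h : e ∈ G.graph.edgeSet
      · have hγ0 : γ = 0 := le_antisymm (not_lt.1 fun h' => hpos ⟨e, h, h'⟩) hγ
        have := hwt e h
        rw [hγ0, mul_zero] at this
        exact le_antisymm this.2 this.1
      · exact G.weight_eq_zero e h
    have huniv : {ω | ∀ S ⊆ VC, |G.minExtCut VC S - (G.lightAndSample light
        ((VCᶜ \ light).filter fun x => coin x ω = true)).minExtCut VC S| ≤
          ε * G.minExtCut VC S} = Set.univ := by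
      refine Set.eq_univ_of_forall fun ω S hS => ?_
      rw [WeightedGraph.minExtCut_sub_lightAndSample hb hl hS fun x => coin x ω,
        WeightedGraph.minExtCut_eq_sum_starCut hb hS]
      simp [WeightedGraph.starCut, WeightedGraph.weightTo, hw]
    rw [huniv, probReal_univ]
    have : 0 ≤ (Fintype.card V : ℝ) ^ (-c₂) := by positivity
    linarith
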